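/- Let $\Gamma$ be a countable group with a left-invariant distance $d$ that is proper (all balls are finite); write $|g|=d(g,e)$ and $B(e,n)=\{g:|g|\le n\}$. Assume that $v=\liminf_n \frac1n\log\#B(e,n)$ is finite. Let $\mu$ be a symmetric probability measure on $\Gamma$ (that is, $\mu(g^{-1})=\mu(g)$) with finite second moment, and put $M_2=M_2(\mu)=\bigl(\sum_g|g|^2\mu(g)\bigr)^{1/2}<\infty$. Denote by $\mu^{*n}$ the $n$-fold convolution of $\mu$ and by $\rho=\limsup_n\mu^{*n}(e)^{1/n}$ the spectral radius. Then the drift $\ell=\lim_n\frac1n\sum_g|g|\,\mu^{*n}(g)$ exists and is finite. Put $\tilde\ell=\ell/M_2$ (read as $0$ if $M_2=0$, i.e. if $\mu=\delta_e$) and $\tilde v=M_2 v$. Then $$\tilde\ell\le\tanh(\tilde v/2),\qquad \rho\ge\frac1{\cosh(\tilde v/2)}.$$ If moreover $H(\mu)=-\sum_g\mu(g)\log\mu(g)$ is finite, or if the balls grow at most exponentially (there is $C$ with $\#B(e,n)\le e^{Cn}$ for all $n\ge1$), then $H(\mu^{*n})=-\sum_g\mu^{*n}(g)\log\mu^{*n}(g)$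 is finite for every $n$, the asymptotic entropy $h=\lim_n\frac1n H(\mu^{*n})$ exists and is finite, and $$h\le\tilde v\,\tanh(\tilde v/2).$$ -/

import Mathlib

namespace RandomWalk

noncomputable section

open Filter Topology

/-- The law `μ^{*n}` of `X_n = γ₁ ⋯ γ_n`, where the `γ_i` are independent with law `μ`. -/
def convPow {Γ : Type*} [Group Γ] (μ : PMF Γ) : ℕ → PMF Γ
  | 0 => PMF.pure 1
  | n + 1 => (convPow μ n).bind fun x => μ.map fun y => x * y

/-- `μ` is symmetric. -/
def IsSymmetric {Γ : Type*} [Group Γ] (μ : PMF Γ) : Prop :=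
  ∀ g : Γ, μ g⁻¹ = μ g

/-- The distance is proper: all balls around the identity are finite. -/
def ProperDist (Γ : Type*) [Group Γ] [MetricSpace Γ] : Prop :=
  ∀ r : ℝ, (Metric.closedBall (1 : Γ) r).Finite

/-- The exponential growth rate `v = liminf (1/n) log #B(e,n)`, with values in `[0, ∞]`. -/
def volumeGrowth (Γ : Type*) [Group Γ] [MetricSpace Γ] : EReal :=
  liminf (fun n : ℕ =>
    ((Real.log ((Metric.closedBall (1 : Γ) (n : ℝ)).ncard : ℝ) / (n : ℝ) : ℝ) : EReal)) atTop

/-- The cardinality of the balls `B(e,n)` grows at most exponentially. -/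
def AtMostExponentialGrowth (Γ : Type*) [Group Γ] [MetricSpace Γ] : Prop :=
  ∃ C : ℝ, ∀ n : ℕ, 1 ≤ n →
    ((Metric.closedBall (1 : Γ) (n : ℝ)).ncard : ℝ) ≤ Real.exp (C * (n : ℝ))

/-- `μ` has a finite second moment. -/
def FiniteSecondMoment {Γ : Type*} [Group Γ] [MetricSpace Γ] (μ : PMF Γ) : Prop :=
  Summable fun g : Γ => dist g 1 ^ 2 * (μ g).toReal

/-- `M₂(μ) = (∑_g |g|² μ(g))^{1/2}`. -/
def M₂ {Γ : Type*} [Group Γ] [MetricSpace Γ] (μ : PMF Γ) : ℝ :=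
  Real.sqrt (∑' g : Γ, dist g 1 ^ 2 * (μ g).toReal)

/-- `H(μ) = -∑_g μ(g) log μ(g)` is finite (all terms are nonnegative). -/
def FiniteEntropy {Γ : Type*} (μ : PMF Γ) : Prop :=
  Summable fun g : Γ => Real.negMulLog (μ g).toReal

/-- `ℓ` is the drift of the walk: every `∑_g |g| μ^{*n}(g)` is finite, and
`ℓ = lim (1/n) ∑_g |g| μ^{*n}(g)`. -/
def IsDrift {Γ : Type*} [Group Γ] [MetricSpace Γ] (μ : PMF Γ) (ℓ : ℝ) : Prop :=
  (∀ n : ℕ, Summable fun g : Γ => dist g 1 * (convPow μ n g).toReal) ∧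
  Tendsto (fun n : ℕ => (∑' g : Γ, dist g 1 * (convPow μ n g).toReal) / (n : ℝ)) atTop (𝓝 ℓ)

/-- `h` is the asymptotic entropy of the walk: every `H(μ^{*n})` is finite, and
`h = lim (1/n) H(μ^{*n})`. -/
def IsAsymptoticEntropy {Γ : Type*} [Group Γ] (μ : PMF Γ) (h : ℝ) : Prop :=
  (∀ n : ℕ, FiniteEntropy (convPow μ n)) ∧
  Tendsto (fun n : ℕ => (∑' g : Γ, Real.negMulLog (convPow μ n g).toReal) / (n : ℝ))
    atTop (𝓝 h)

/-- The spectral radius `ρ = limsup (μ^{*n}(e))^{1/n}`, a limsup of numbers in `[0, 1]`. -/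
def spectralRadius {Γ : Type*} [Group Γ] (μ : PMF Γ) : ℝ :=
  limsup (fun n : ℕ => (convPow μ n 1).toReal ^ (1 / (n : ℝ))) atTop

end

end RandomWalk

/-!
The drift bound compares entropy production with length production. Let `u` be the time average
of the laws `μ^{*k}`, `k < n`, closed off by the law `q` of the walk at time `n` plus an
independent geometric time; this delay makes the balance `P u - u = (q - δ_e) / (n + 1)` exact, and
gives `q ≤ (n + 1) u`. By symmetry of `μ`, summation by parts turns the growth of `|·|` and of
`-log u` along the walk into sums over edges `x — xγ` of `(u x - u (xγ)) (F (xγ) - F x) / 2`.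
On a single edge, AM–GM together with the convexity of `r² ↦ r artanh r` bounds the entropy
production from below in terms of the length production, at a cost quadratic in `|γ|`, whose average
over `γ` involves only `M₂`. As the entropy of `μ` may be infinite, `log u` is truncated at
`exp (-K n)`. On the other side, `|X_n|` concentrates near `ℓ n`, so the
walk sits in a ball of cardinality about `exp (v ℓ n)` and produces at most `v ℓ` of entropy per
step. Optimising the slope gives `ℓ ≤ M₂ tanh (M₂ v / 2)`, and the entropy bound follows
from the fundamental inequality `h ≤ ℓ v`.

The spectral radius dominates the Rayleigh quotients of the functions `exp (-t |x|)` cut off at a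
ball; for `t` slightly above `v / 2` there are radii for which the boundary term is negligible, and
the convexity of `r² ↦ 1 / cosh (t r)` bounds the quotient below by `1 / cosh (t M₂)`.
-/

namespace RandomWalk

noncomputable section

open Filter Topology

/-- The weight of a point under a probability mass function, as a real number. -/
def wt {α : Type*} (a : PMF α) (x : α) : ℝ := (a x).toReal

section Weights

variable {α : Type*}

lemma wt_nonneg (a : PMF α) (x : α) : 0 ≤ wt a x := ENNReal.toReal_nonneg

lemma hasSum_wt (a : PMF α) : HasSum (wt a) 1 := by
  have h := (ENNReal.summable_toReal a.tsum_coe_ne_top).hasSum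
  rwa [← ENNReal.tsum_toReal_eq a.apply_ne_top, a.tsum_coe, ENNReal.toReal_one] at h

lemma summable_wt (a : PMF α) : Summable (wt a) := (hasSum_wt a).summable

lemma wt_le_one (a : PMF α) (x : α) : wt a x ≤ 1 :=
  ENNReal.toReal_le_of_le_ofReal zero_le_one (by simpa using a.coe_le_one x)

lemma hasSum_mul_prod {β : Type*} {f : α → ℝ} {g : β → ℝ} {s t : ℝ}
    (hf : HasSum f s) (hg : HasSum g t) :
    HasSum (fun p : α × β => f p.1 * g p.2) (s * t) :=
  hf.mul hg (summable_mul_of_summable_norm hf.summable.norm hg.summable.norm)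

lemma summable_wt_mul_of_abs_le (a : PMF α) {F : α → ℝ} {C : ℝ} (hF : ∀ x, |F x| ≤ C) :
    Summable fun x => wt a x * F x := by
  refine Summable.of_norm_bounded ((summable_wt a).mul_right C) fun x => ?_
  rw [Real.norm_eq_abs, abs_mul, abs_of_nonneg (wt_nonneg a x)]
  exact mul_le_mul_of_nonneg_left (hF x) (wt_nonneg a x)

lemma summable_wt_mul_of_le (a : PMF α) {F G : α → ℝ} (hF : ∀ x, 0 ≤ F x)
    (hFG : ∀ x, 0 < wt a x → F x ≤ G x) (hG : Summable fun x => wt a x * G x) :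
    (Summable fun x => wt a x * F x) ∧ ∑' x, wt a x * F x ≤ ∑' x, wt a x * G x := by
  have hle : ∀ x, wt a x * F x ≤ wt a x * G x := fun x => by
    rcases (wt_nonneg a x).eq_or_lt with h | h
    · simp [← h]
    · exact mul_le_mul_of_nonneg_left (hFG x h) h.le
  have hs := Summable.of_nonneg_of_le (fun x => mul_nonneg (wt_nonneg a x) (hF x)) hle hG
  exact ⟨hs, hs.tsum_le_tsum hle hG⟩

end Weights

section Convolution

variable {Γ : Type*} [Group Γ]

/-- The convolution of two laws on a group, that is the law of `x * y` for independent `x` and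
`y`; the operation iterated by `convPow`. -/
def mulConv (a b : PMF Γ) : PMF Γ := a.bind fun x => b.map fun y => x * y

lemma mulConv_apply (a b : PMF Γ) (z : Γ) : mulConv a b z = ∑' x, a x * b (x⁻¹ * z) := by
  classical
  rw [mulConv, PMF.bind_apply]
  refine tsum_congr fun x => ?_
  rw [PMF.map_apply, tsum_eq_single (x⁻¹ * z)]
  · simp
  · intro y hy
    rw [if_neg]
    rintro rfl
    simp at hy

lemma wt_mulConv (a b : PMF Γ) (z : Γ) :
    wt (mulConv a b) z = ∑' x, wt a x * wt b (x⁻¹ * z) := by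
  rw [wt, mulConv_apply, ENNReal.tsum_toReal_eq
    fun x => ENNReal.mul_ne_top (a.apply_ne_top x) (b.apply_ne_top _)]
  simp [wt]

lemma summable_wt_mulConv (a b : PMF Γ) (z : Γ) :
    Summable fun x => wt a x * wt b (x⁻¹ * z) :=
  Summable.of_nonneg_of_le (fun _ => mul_nonneg (wt_nonneg a _) (wt_nonneg b _))
    (fun x => mul_le_of_le_one_right (wt_nonneg a x) (wt_le_one b _)) (summable_wt a)

lemma mul_wt_le_wt_mulConv (a b : PMF Γ) (x y : Γ) :
    wt a x * wt b y ≤ wt (mulConv a b) (x * y) := by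
  rw [wt_mulConv]
  have := (summable_wt_mulConv a b (x * y)).le_tsum x
    fun _ _ => mul_nonneg (wt_nonneg a _) (wt_nonneg b _)
  simpa using this

/-- The change of variables that lists the factorisations `z = x * (x⁻¹ * z)` of each `z`. -/
def factorEquiv (Γ : Type*) [Group Γ] : Γ × Γ ≃ Γ × Γ where
  toFun p := (p.2, p.2⁻¹ * p.1)
  invFun p := (p.1 * p.2, p.1)
  left_inv p := by simp
  right_inv p := by simp

lemma hasSum_mulConv (a b : PMF Γ) {F : Γ → ℝ} {s : ℝ}
    (h : HasSum (fun p : Γ × Γ => wt a p.1 * wt b p.2 * F (p.1 * p.2)) s) :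
    HasSum (fun z => wt (mulConv a b) z * F z) s := by
  have h' := (factorEquiv Γ).hasSum_iff.2 h
  refine h'.prod_fiberwise fun z => ?_
  have hz := (h'.summable.prod_factor z).hasSum
  have e : wt (mulConv a b) z * F z = ∑' x, ((fun p : Γ × Γ => wt a p.1 * wt b p.2 *
      F (p.1 * p.2)) ∘ factorEquiv Γ) (z, x) := by
    rw [wt_mulConv, ← tsum_mul_right]
    simp [factorEquiv]
  rwa [e]

lemma mulConv_tsum_le (a b : PMF Γ) {F : Γ → ℝ} {Φ : Γ × Γ → ℝ} {s : ℝ}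
    (hF : ∀ x, 0 ≤ F x)
    (hFΦ : ∀ x y, 0 < wt a x → 0 < wt b y → F (x * y) ≤ Φ (x, y))
    (hΦ : HasSum (fun p : Γ × Γ => wt a p.1 * wt b p.2 * Φ p) s) :
    (Summable fun z => wt (mulConv a b) z * F z) ∧
      ∑' z, wt (mulConv a b) z * F z ≤ s := by
  have hle : ∀ p : Γ × Γ, wt a p.1 * wt b p.2 * F (p.1 * p.2) ≤ wt a p.1 * wt b p.2 * Φ p := by
    rintro ⟨x, y⟩
    rcases (wt_nonneg a x).eq_or_lt with hx | hx
    · simp [← hx]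
    rcases (wt_nonneg b y).eq_or_lt with hy | hy
    · simp [← hy]
    exact mul_le_mul_of_nonneg_left (hFΦ x y hx hy) (mul_nonneg hx.le hy.le)
  have hs := Summable.of_nonneg_of_le (fun p : Γ × Γ => mul_nonneg
    (mul_nonneg (wt_nonneg a p.1) (wt_nonneg b p.2)) (hF (p.1 * p.2))) hle hΦ.summable
  have h := hasSum_mulConv a b hs.hasSum
  exact ⟨h.summable, h.tsum_eq ▸ (hs.tsum_le_tsum hle hΦ.summable).trans_eq hΦ.tsum_eq⟩

lemma mulConv_tsum_le_add (a b : PMF Γ) {F G H : Γ → ℝ} (hF : ∀ x, 0 ≤ F x)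
    (hFGH : ∀ x y, 0 < wt a x → 0 < wt b y → F (x * y) ≤ G x + H y)
    (hG : Summable fun x => wt a x * G x) (hH : Summable fun x => wt b x * H x) :
    (Summable fun z => wt (mulConv a b) z * F z) ∧
      ∑' z, wt (mulConv a b) z * F z ≤ ∑' x, wt a x * G x + ∑' x, wt b x * H x := by
  refine mulConv_tsum_le a b (Φ := fun p => G p.1 + H p.2) hF hFGH ?_
  have h1 := hasSum_mul_prod hG.hasSum (hasSum_wt b)
  have h2 := hasSum_mul_prod (hasSum_wt a) hH.hasSum
  rw [mul_one] at h1
  rw [one_mul] at h2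
  convert h1.add h2 using 2 with p
  ring

lemma convPow_succ (μ : PMF Γ) (n : ℕ) : convPow μ (n + 1) = mulConv (convPow μ n) μ := rfl

lemma mulConv_assoc (a b c : PMF Γ) : mulConv (mulConv a b) c = mulConv a (mulConv b c) := by
  simp only [mulConv, PMF.bind_bind, PMF.map_bind, PMF.bind_map, PMF.map_comp]
  congr 1; funext x
  congr 1; funext y
  simp [Function.comp_def, mul_assoc]

lemma mulConv_pure_one (a : PMF Γ) : mulConv a (PMF.pure 1) = a := by
  simp [mulConv, PMF.pure_map]

lemma pure_one_mulConv (a : PMF Γ) : mulConv (PMF.pure 1) a = a := by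
  simp only [mulConv, PMF.pure_bind, one_mul]
  exact PMF.map_id a

lemma convPow_add (μ : PMF Γ) (m n : ℕ) :
    convPow μ (m + n) = mulConv (convPow μ m) (convPow μ n) := by
  induction n with
  | zero => exact (mulConv_pure_one _).symm
  | succ n ih => rw [← add_assoc, convPow_succ, ih, mulConv_assoc, ← convPow_succ]

lemma convPow_mul (μ : PMF Γ) (m k : ℕ) : convPow μ (m * k) = convPow (convPow μ m) k := by
  induction k with
  | zero => rfl
  | succ k ih => rw [Nat.mul_succ, convPow_add, ih, ← convPow_succ]

lemma convPow_one (μ : PMF Γ) : convPow μ 1 = μ := pure_one_mulConv μ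

lemma wt_pure_one (x : Γ) [Decidable (x = 1)] :
    wt (PMF.pure (1 : Γ)) x = if x = 1 then 1 else 0 := by
  classical
  rw [wt, PMF.pure_apply]
  split_ifs <;> simp

lemma hasSum_wt_pure_one (F : Γ → ℝ) : HasSum (fun x => wt (PMF.pure (1 : Γ)) x * F x) (F 1) := by
  classical
  convert hasSum_ite_eq (1 : Γ) (F 1) using 2 with x
  rw [wt_pure_one]
  split_ifs with h <;> simp [h]

lemma IsSymmetric.wt_inv {μ : PMF Γ} (h : IsSymmetric μ) (g : Γ) : wt μ g⁻¹ = wt μ g := by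
  rw [wt, wt, h g]

end Convolution

section Length

variable {Γ : Type*} [Group Γ] [MetricSpace Γ] [IsIsometricSMul Γ Γ]

lemma dist_mul_self_left (x y : Γ) : dist (x * y) x = dist y 1 := by
  simpa using dist_mul_left x y 1

lemma dist_mul_one_le (x y : Γ) : dist (x * y) 1 ≤ dist x 1 + dist y 1 := by
  have := dist_triangle (x * y) x 1
  rw [dist_mul_self_left] at this
  linarith

lemma abs_dist_mul_sub_le (x y : Γ) : |dist (x * y) 1 - dist x 1| ≤ dist y 1 := by
  rw [← dist_mul_self_left x y]
  exact abs_dist_sub_le _ _ _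

end Length

section Hyperbolic

open Real

lemma hasDerivAt_tanh (t : ℝ) : HasDerivAt tanh (1 / cosh t ^ 2) t := by
  have h := (hasDerivAt_sinh t).fun_div (hasDerivAt_cosh t) (cosh_pos t).ne'
  rw [← sq, ← sq, cosh_sq_sub_sinh_sq] at h
  exact h.congr_of_eventuallyEq (.of_forall tanh_eq_sinh_div_cosh)

lemma tanh_pos_of_pos {t : ℝ} (ht : 0 < t) : 0 < tanh t := by
  rw [tanh_eq_sinh_div_cosh]
  exact div_pos (sinh_pos_iff.2 ht) (cosh_pos t)

lemma continuous_tanh : Continuous tanh :=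
  continuous_iff_continuousAt.2 fun t => (hasDerivAt_tanh t).continuousAt

lemma cosh_mono {s t : ℝ} (hs : 0 ≤ s) (hst : s ≤ t) : cosh s ≤ cosh t := by
  rwa [cosh_le_cosh, abs_of_nonneg hs, abs_of_nonneg (hs.trans hst)]

lemma le_sinh_mul_cosh {t : ℝ} (ht : 0 ≤ t) : t ≤ sinh t * cosh t :=
  (self_le_sinh_iff.2 ht).trans
    (le_mul_of_one_le_right (sinh_nonneg_iff.2 ht) (one_le_cosh t))

lemma le_of_deriv_nonpos_of_deriv_nonneg {g g' : ℝ → ℝ} {a c t : ℝ}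
    (hg : ∀ x, HasDerivAt g (g' x) x) (hneg : ∀ x, a < x → x < c → g' x ≤ 0)
    (hpos : ∀ x, c < x → 0 ≤ g' x) (hac : a ≤ c) (hat : a ≤ t) : g c ≤ g t := by
  have hdiff : Differentiable ℝ g := fun x => (hg x).differentiableAt
  rcases le_total t c with h | h
  · refine antitoneOn_of_deriv_nonpos (convex_Icc a c) hdiff.continuous.continuousOn
      hdiff.differentiableOn (fun x hx => ?_) ⟨hat, h⟩ ⟨hac, le_rfl⟩ h
    rw [interior_Icc] at hx
    exact (hg x).deriv.trans_le (hneg x hx.1 hx.2)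
  · refine monotoneOn_of_deriv_nonneg (convex_Ici c) hdiff.continuous.continuousOn
      hdiff.differentiableOn (fun x hx => ?_) Set.self_mem_Ici h h
    rw [interior_Ici] at hx
    exact (hpos x hx).trans_eq (hg x).deriv.symm

lemma mul_tanh_le_mul_tanh {s t : ℝ} (hs : 0 < s) (hst : s ≤ t) : s * tanh t ≤ t * tanh s := by
  have hg : ∀ x, HasDerivAt (fun x => x * tanh s - s * tanh x)
      (1 * tanh s - s * (1 / cosh x ^ 2)) x := fun x =>
    ((hasDerivAt_id x).mul_const _).sub ((hasDerivAt_tanh x).const_mul s)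
  have hpos : ∀ x, s < x → 0 ≤ 1 * tanh s - s * (1 / cosh x ^ 2) := fun x hx => by
    have hcosh : s * (1 / cosh x ^ 2) ≤ s * (1 / cosh s ^ 2) := by
      have := cosh_pos s
      gcongr
      exact cosh_mono hs.le hx.le
    have htanh : s * (1 / cosh s ^ 2) ≤ tanh s := by
      rw [tanh_eq_sinh_div_cosh, mul_one_div, div_le_div_iff₀ (pow_pos (cosh_pos s) 2) (cosh_pos s)]
      nlinarith [le_sinh_mul_cosh hs.le, cosh_pos s]
    linarith
  have hmin : s * tanh s - s * tanh s ≤ t * tanh s - s * tanh t :=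
    le_of_deriv_nonpos_of_deriv_nonneg hg (fun x hx hxs => absurd hx hxs.not_gt) hpos le_rfl hst
  linarith

/-- The derivative of `x ↦ x * artanh x` at `x = tanh τ`; it is the exchange rate between length
and entropy in the edge inequalities. -/
def artanhSlope (τ : ℝ) : ℝ := sinh τ * cosh τ + τ

lemma two_mul_le_artanhSlope {τ : ℝ} (hτ : 0 ≤ τ) : 2 * τ ≤ artanhSlope τ := by
  have := le_sinh_mul_cosh hτ
  rw [artanhSlope]
  linarith

lemma artanhSlope_pos {τ : ℝ} (hτ : 0 < τ) : 0 < artanhSlope τ := by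
  linarith [two_mul_le_artanhSlope hτ.le]

-- The tangent at `tanh τ ^ 2` of the convex function `x ↦ √x * artanh √x`, for `x = tanh t ^ 2`.
lemma mul_tanh_tangent {t τ : ℝ} (ht : 0 ≤ t) (hτ : 0 < τ) :
    τ * tanh τ + artanhSlope τ / (2 * tanh τ) * (tanh t ^ 2 - tanh τ ^ 2) ≤ t * tanh t := by
  set B := artanhSlope τ / (2 * tanh τ) with hB
  have hT := tanh_pos_of_pos hτ
  have hg : ∀ x, HasDerivAt (fun x => x * tanh x - B * tanh x ^ 2)
      (((cosh x ^ 2 - cosh τ ^ 2) * tanh x + (x * tanh τ - τ * tanh x) / tanh τ) /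
        cosh x ^ 2) x := fun x => by
    refine (((hasDerivAt_id x).mul (hasDerivAt_tanh x)).sub
      (((hasDerivAt_tanh x).pow 2).const_mul B)).congr_deriv ?_
    have := (cosh_pos x).ne'
    have := (cosh_pos τ).ne'
    have := (sinh_pos_iff.2 hτ).ne'
    rw [hB, artanhSlope, tanh_eq_sinh_div_cosh τ, id]
    field_simp
    ring
  have hmin := le_of_deriv_nonpos_of_deriv_nonneg (a := 0) (c := τ) (t := t) hg ?_ ?_ hτ.le ht
  · linarith
  · intro x hx hxτ
    have hcosh := pow_le_pow_left₀ (cosh_pos x).le (cosh_mono hx.le hxτ.le) 2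
    have htanh := mul_tanh_le_mul_tanh hx hxτ.le
    refine div_nonpos_of_nonpos_of_nonneg (add_nonpos ?_ ?_) (sq_nonneg _)
    · exact mul_nonpos_of_nonpos_of_nonneg (by linarith) (tanh_pos_of_pos hx).le
    · exact div_nonpos_of_nonpos_of_nonneg (by linarith) hT.le
  · intro x hτx
    have hcosh := pow_le_pow_left₀ (cosh_pos τ).le (cosh_mono hτ.le hτx.le) 2
    have htanh := mul_tanh_le_mul_tanh hτ hτx.le
    refine div_nonneg (add_nonneg ?_ ?_) (sq_nonneg _)
    · exact mul_nonneg (by linarith) (tanh_pos_of_pos (hτ.trans hτx)).le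
    · exact div_nonneg (by linarith) hT.le

-- The tangent at `b ^ 2` of the convex function `x ↦ 1 / cosh √x`, for `x = a ^ 2`.
lemma one_div_cosh_tangent {a b : ℝ} (ha : 0 ≤ a) (hb : 0 < b) :
    1 / cosh b - tanh b / (2 * b * cosh b) * (a ^ 2 - b ^ 2) ≤ 1 / cosh a := by
  set k := tanh b / (2 * b * cosh b) with hk
  have hg : ∀ x, HasDerivAt (fun x => 1 / cosh x + k * x ^ 2)
      ((x * tanh b / cosh b - b * tanh x / cosh x) / b) x := fun x => by
    refine (((hasDerivAt_const x (1 : ℝ)).div (hasDerivAt_cosh x) (cosh_pos x).ne').add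
      (((hasDerivAt_id x).pow 2).const_mul k)).congr_deriv ?_
    have := (cosh_pos x).ne'
    have := (cosh_pos b).ne'
    rw [hk, tanh_eq_sinh_div_cosh x, id]
    field_simp
    ring
  have hmin := le_of_deriv_nonpos_of_deriv_nonneg (a := 0) (c := b) (t := a) hg ?_ ?_ hb.le ha
  · linarith
  · intro x hx hxb
    refine div_nonpos_of_nonpos_of_nonneg (sub_nonpos.2 ?_) hb.le
    exact div_le_div₀ (mul_nonneg hb.le (tanh_pos_of_pos hx).le)
      (mul_tanh_le_mul_tanh hx hxb.le) (cosh_pos x) (cosh_mono hx.le hxb.le)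
  · intro x hbx
    refine div_nonneg (sub_nonneg.2 ?_) hb.le
    exact div_le_div₀ (mul_nonneg (hb.trans hbx).le (tanh_pos_of_pos hb).le)
      (mul_tanh_le_mul_tanh hb hbx.le) (cosh_pos b) (cosh_mono hb.le hbx.le)

/-- What an edge of relative length `r = |γ| / M₂` costs in `edge_production`, per unit of mass.
The average over `γ` of law `μ` is `2 * tanh τ * (sinh τ * cosh τ)`, because `r ^ 2` has
mean `1`. -/
def edgeCost (τ r : ℝ) : ℝ := tanh τ * (artanhSlope τ * (1 + r ^ 2) - 2 * τ)

lemma edgeCost_nonneg {τ : ℝ} (hτ : 0 < τ) (r : ℝ) : 0 ≤ edgeCost τ r := by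
  have := two_mul_le_artanhSlope hτ.le
  refine mul_nonneg (tanh_pos_of_pos hτ).le ?_
  nlinarith [sq_nonneg r]

lemma artanhSlope_mul_tanh_sub_edgeCost_le {t τ : ℝ} (ht : 0 ≤ t) (hτ : 0 < τ) (r : ℝ) :
    2 * artanhSlope τ * r * tanh t - edgeCost τ r ≤ 2 * (t * tanh t) := by
  have hT := tanh_pos_of_pos hτ
  have hD := artanhSlope_pos hτ
  have hsq : 0 ≤ artanhSlope τ / tanh τ * (tanh t - tanh τ * r) ^ 2 := by positivity
  calc 2 * artanhSlope τ * r * tanh t - edgeCost τ r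
      ≤ 2 * artanhSlope τ * r * tanh t - edgeCost τ r
        + artanhSlope τ / tanh τ * (tanh t - tanh τ * r) ^ 2 := le_add_of_nonneg_right hsq
    _ = 2 * (τ * tanh τ + artanhSlope τ / (2 * tanh τ) * (tanh t ^ 2 - tanh τ ^ 2)) := by
      rw [edgeCost]
      field_simp
      ring
    _ ≤ 2 * (t * tanh t) := by linarith [mul_tanh_tangent ht hτ]

lemma exists_eq_mul_exp {w w' : ℝ} (hw : 0 < w) (hw' : 0 < w') :
    ∃ a t, 0 < a ∧ w = a * exp t ∧ w' = a * exp (-t) := by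
  refine ⟨exp ((log w + log w') / 2), (log w - log w') / 2, exp_pos _, ?_, ?_⟩
  · rw [← exp_add]
    ring_nf
    exact (exp_log hw).symm
  · rw [← exp_add]
    ring_nf
    exact (exp_log hw').symm

lemma edge_production {w w' τ : ℝ} (hw : 0 < w) (hw' : 0 < w') (hτ : 0 < τ) (r : ℝ) :
    artanhSlope τ * r * |w - w'| - (w + w') / 2 * edgeCost τ r ≤
      (w - w') * (log w - log w') / 2 := by
  wlog hle : w' ≤ w generalizing w w'
  · have := this hw' hw (le_of_not_ge hle)
    rw [abs_sub_comm] at this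
    linarith
  obtain ⟨a, t, ha, rfl, rfl⟩ := exists_eq_mul_exp hw hw'
  have ht : 0 ≤ t := by
    have := exp_le_exp.1 (le_of_mul_le_mul_left hle ha)
    linarith
  have hsub : a * exp t - a * exp (-t) = 2 * (a * cosh t) * tanh t := by
    rw [tanh_eq_sinh_div_cosh, mul_assoc, mul_assoc, mul_div_cancel₀ _ (cosh_pos t).ne', sinh_eq]
    ring
  have hadd : a * exp t + a * exp (-t) = 2 * (a * cosh t) := by rw [cosh_eq]; ring
  have hlog : log (a * exp t) - log (a * exp (-t)) = 2 * t := by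
    rw [log_mul ha.ne' (exp_ne_zero _), log_mul ha.ne' (exp_ne_zero _), log_exp, log_exp]
    ring
  have hmul := mul_le_mul_of_nonneg_left (artanhSlope_mul_tanh_sub_edgeCost_le ht hτ r)
    (mul_pos ha (cosh_pos t)).le
  rw [abs_of_nonneg (sub_nonneg.2 hle), hsub, hadd, hlog]
  linarith

/-- Truncating the logarithm at `κ` weakens `edge_production` by the truncated masses `min u κ`
and `min u' κ` only. -/
lemma edge_production_truncated {u u' κ τ r : ℝ} (hu : 0 ≤ u) (hu' : 0 ≤ u') (hκ : 0 < κ)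
    (hτ : 0 < τ) (hr : 0 ≤ r) :
    artanhSlope τ * r * (|u - u'| - (min u κ + min u' κ))
      - (u + u' + min u κ + min u' κ) / 2 * edgeCost τ r ≤
      (u - u') * (log (max u κ) - log (max u' κ)) / 2 := by
  wlog hle : u' ≤ u generalizing u u'
  · have := this hu' hu (le_of_not_ge hle)
    rw [abs_sub_comm] at this
    linarith
  have hcost := edgeCost_nonneg hτ r
  have hDr : 0 ≤ artanhSlope τ * r := mul_nonneg (artanhSlope_pos hτ).le hr
  have hmin' : 0 ≤ min u' κ := le_min hu' hκ.le
  rw [abs_of_nonneg (sub_nonneg.2 hle)]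
  rcases le_or_gt u κ with huκ | hκu
  · rw [max_eq_right huκ, max_eq_right (hle.trans huκ), sub_self, mul_zero, zero_div,
      min_eq_left huκ, min_eq_left (hle.trans huκ)]
    nlinarith [mul_nonneg hDr hu', mul_nonneg (add_nonneg hu hu') hcost]
  · have hprod := edge_production (hκ.trans hκu) (lt_max_of_lt_right hκ : 0 < max u' κ) hτ r
    have hadd : max u' κ + min u' κ = u' + κ := max_add_min u' κ
    have hlog : log (max u' κ) ≤ log u :=
      log_le_log (lt_max_of_lt_right hκ) (max_le hle hκu.le)
    rw [abs_of_nonneg (sub_nonneg.2 (max_le hle hκu.le))] at hprod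
    rw [max_eq_left hκu.le, min_eq_right hκu.le]
    have hlen : artanhSlope τ * r * (u - u' - (κ + min u' κ)) ≤
        artanhSlope τ * r * (u - max u' κ) :=
      mul_le_mul_of_nonneg_left (by linarith) hDr
    have hmass : (u + max u' κ) / 2 * edgeCost τ r ≤
        (u + u' + κ + min u' κ) / 2 * edgeCost τ r :=
      mul_le_mul_of_nonneg_right (by linarith) hcost
    have hgap : (u - max u' κ) * (log u - log (max u' κ)) ≤
        (u - u') * (log u - log (max u' κ)) :=
      mul_le_mul_of_nonneg_right (by linarith [le_max_left u' κ]) (sub_nonneg.2 hlog)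
    linarith

end Hyperbolic

section Moments

variable {Γ : Type*} [Group Γ] [MetricSpace Γ]

/-- The mean `E|Y|` of the length of a random element `Y` of law `a`. -/
def meanLength (a : PMF Γ) : ℝ := ∑' x, wt a x * dist x 1

lemma meanLength_nonneg (a : PMF Γ) : 0 ≤ meanLength a :=
  tsum_nonneg fun x => mul_nonneg (wt_nonneg a x) dist_nonneg

lemma FiniteSecondMoment.summable {a : PMF Γ} (h : FiniteSecondMoment a) :
    Summable fun x => wt a x * dist x 1 ^ 2 :=
  h.congr fun _ => mul_comm _ _

lemma FiniteSecondMoment.summable_dist {a : PMF Γ} (h : FiniteSecondMoment a) :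
    Summable fun x => wt a x * dist x 1 := by
  refine (summable_wt_mul_of_le a (G := fun x => 1 + dist x 1 ^ 2) (fun _ => dist_nonneg)
    (fun x _ => by nlinarith [sq_nonneg (dist x 1 - 1)]) ?_).1
  simpa only [mul_add, mul_one] using (summable_wt a).add h.summable

lemma FiniteSecondMoment.hasSum_dist {a : PMF Γ} (h : FiniteSecondMoment a) :
    HasSum (fun x => wt a x * dist x 1) (meanLength a) :=
  h.summable_dist.hasSum

lemma M₂_nonneg (a : PMF Γ) : 0 ≤ M₂ a := Real.sqrt_nonneg _

lemma hasSum_M₂_sq {a : PMF Γ} (h : FiniteSecondMoment a) :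
    HasSum (fun x => wt a x * dist x 1 ^ 2) (M₂ a ^ 2) := by
  rw [M₂, Real.sq_sqrt (tsum_nonneg fun x => by positivity)]
  simpa only [wt, mul_comm] using Summable.hasSum h

lemma meanLength_eq_zero_of_M₂_eq_zero {a : PMF Γ} (h : FiniteSecondMoment a) (h0 : M₂ a = 0) :
    meanLength a = 0 := by
  have hs := hasSum_M₂_sq h
  rw [h0, zero_pow two_ne_zero,
    hasSum_zero_iff_of_nonneg fun x => mul_nonneg (wt_nonneg a x) (sq_nonneg _)] at hs
  have hzero : ∀ x, wt a x * dist x 1 = 0 := fun x => by simpa using congrFun hs x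
  simp [meanLength, hzero]

lemma bddBelow_meanLength_div (μ : PMF Γ) :
    BddBelow (Set.range fun n : ℕ => meanLength (convPow μ n) / n) :=
  ⟨0, by
    rintro _ ⟨n, rfl⟩
    exact div_nonneg (meanLength_nonneg _) n.cast_nonneg⟩

/-- The second moment of the excess `(|Y| - α)⁺` of the length over `α`, for `Y` of law `a`. -/
def excess (a : PMF Γ) (α : ℝ) : ℝ := ∑' x, wt a x * max (dist x 1 - α) 0 ^ 2

lemma summable_sq_sub {a : PMF Γ} (h : FiniteSecondMoment a) (β : ℝ) :
    Summable fun x => wt a x * (dist x 1 - β) ^ 2 := by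
  have h1 := (h.summable.sub (h.summable_dist.mul_right (2 * β))).add
    ((summable_wt a).mul_right (β ^ 2))
  refine h1.congr fun x => ?_
  ring

lemma summable_excess {a : PMF Γ} (h : FiniteSecondMoment a) (α : ℝ) :
    Summable fun x => wt a x * max (dist x 1 - α) 0 ^ 2 := by
  refine (summable_wt_mul_of_le a (fun x => sq_nonneg _) (fun x _ => ?_) (summable_sq_sub h α)).1
  rcases le_total (dist x 1 - α) 0 with h | h
  · simpa [max_eq_right h] using sq_nonneg _
  · rw [max_eq_left h]

lemma excess_antitone {a : PMF Γ} (h : FiniteSecondMoment a) : Antitone (excess a) :=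
  fun α β hαβ => (summable_excess h β).tsum_le_tsum (fun x => by
    have := wt_nonneg a x
    gcongr) (summable_excess h α)

/-- The variance of the length `|Y|`, for `Y` of law `b`. -/
def lengthVar (b : PMF Γ) : ℝ := ∑' y, wt b y * (dist y 1 - meanLength b) ^ 2

lemma lengthVar_nonneg (b : PMF Γ) : 0 ≤ lengthVar b :=
  tsum_nonneg fun y => mul_nonneg (wt_nonneg b y) (sq_nonneg _)

/-- The tail `P(|Y| > R)` of the length, for `Y` of law `a`. -/
def tail (a : PMF Γ) (R : ℝ) : ℝ := ∑' x, wt a x * (if R < dist x 1 then 1 else 0)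

lemma summable_tail (a : PMF Γ) (R : ℝ) :
    Summable fun x => wt a x * (if R < dist x 1 then (1 : ℝ) else 0) :=
  summable_wt_mul_of_abs_le a (C := 1) fun x => by split_ifs <;> simp

lemma tail_antitone (a : PMF Γ) : Antitone (tail a) := fun R R' h =>
  (summable_tail a R').tsum_le_tsum (fun x => by
    refine mul_le_mul_of_nonneg_left ?_ (wt_nonneg a x)
    split_ifs with h1 h2
    · exact le_rfl
    · exact absurd (h.trans_lt h1) h2
    · exact zero_le_one
    · exact le_rfl) (summable_tail a R)

lemma tail_nonneg (a : PMF Γ) (R : ℝ) : 0 ≤ tail a R :=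
  tsum_nonneg fun x => mul_nonneg (wt_nonneg a x) (by split_ifs <;> simp)

lemma tail_le_excess_div {a : PMF Γ} (h : FiniteSecondMoment a) {α R : ℝ} (hR : α < R) :
    tail a R ≤ excess a α / (R - α) ^ 2 := by
  have hs := (summable_excess h α).div_const ((R - α) ^ 2)
  rw [excess, ← tsum_div_const]
  refine (summable_tail a R).tsum_le_tsum (fun x => ?_) hs
  rw [mul_div_assoc]
  refine mul_le_mul_of_nonneg_left ?_ (wt_nonneg a x)
  have h0 : 0 < R - α := sub_pos.2 hR
  split_ifs with hx
  · rw [one_le_div (pow_pos h0 2)]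
    have : R - α ≤ max (dist x 1 - α) 0 := le_max_of_le_left (by linarith)
    gcongr
  · positivity

variable [IsIsometricSMul Γ Γ]

lemma FiniteSecondMoment.mulConv {a b : PMF Γ} (ha : FiniteSecondMoment a)
    (hb : FiniteSecondMoment b) : FiniteSecondMoment (mulConv a b) := by
  have h := (mulConv_tsum_le_add a b (F := fun x => dist x 1 ^ 2)
    (G := fun x => dist x 1 ^ 2 * 2) (H := fun x => dist x 1 ^ 2 * 2) (fun x => sq_nonneg _)
    (fun x y _ _ => ?_) ?_ ?_).1
  · exact h.congr fun x => mul_comm _ _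
  · have h1 := dist_mul_one_le x y
    have h2 : (0 : ℝ) ≤ dist (x * y) 1 := dist_nonneg
    nlinarith [sq_nonneg (dist x 1 - dist y 1)]
  · simpa only [mul_assoc] using ha.summable.mul_right 2
  · simpa only [mul_assoc] using hb.summable.mul_right 2

lemma FiniteSecondMoment.convPow {μ : PMF Γ} (h : FiniteSecondMoment μ) (n : ℕ) :
    FiniteSecondMoment (convPow μ n) := by
  induction n with
  | zero =>
    exact (hasSum_wt_pure_one fun x : Γ => dist x 1 ^ 2).summable.congr fun x => mul_comm _ _
  | succ n ih => exact ih.mulConv h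

lemma meanLength_mulConv_le {a b : PMF Γ} (ha : Summable fun x => wt a x * dist x 1)
    (hb : Summable fun x => wt b x * dist x 1) :
    meanLength (mulConv a b) ≤ meanLength a + meanLength b :=
  (mulConv_tsum_le_add a b (fun _ => dist_nonneg) (fun x y _ _ => dist_mul_one_le x y) ha hb).2

lemma subadditive_meanLength {μ : PMF Γ} (h : FiniteSecondMoment μ) :
    Subadditive fun n => meanLength (convPow μ n) := fun m n => by
  simp only [convPow_add]
  exact meanLength_mulConv_le (h.convPow m).summable_dist (h.convPow n).summable_dist

/-- The drift `ℓ` of the walk, as the limit of a subadditive sequence. -/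
def drift {μ : PMF Γ} (h : FiniteSecondMoment μ) : ℝ := (subadditive_meanLength h).lim

lemma tendsto_drift {μ : PMF Γ} (h : FiniteSecondMoment μ) :
    Tendsto (fun n : ℕ => meanLength (convPow μ n) / n) atTop (𝓝 (drift h)) :=
  (subadditive_meanLength h).tendsto_lim (bddBelow_meanLength_div μ)

lemma drift_nonneg {μ : PMF Γ} (h : FiniteSecondMoment μ) : 0 ≤ drift h :=
  ge_of_tendsto' (tendsto_drift h) fun n => div_nonneg (meanLength_nonneg _) n.cast_nonneg

lemma mul_drift_le {μ : PMF Γ} (h : FiniteSecondMoment μ) (n : ℕ) :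
    n * drift h ≤ meanLength (convPow μ n) := by
  rcases eq_or_ne n 0 with rfl | hn
  · simpa using meanLength_nonneg _
  · have := (subadditive_meanLength h).lim_le_div (bddBelow_meanLength_div μ) hn
    rw [le_div_iff₀ (by positivity)] at this
    rw [mul_comm]
    exact this

lemma isDrift_drift {μ : PMF Γ} (h : FiniteSecondMoment μ) : IsDrift μ (drift h) := by
  refine ⟨fun n => (h.convPow n).summable_dist.congr fun x => mul_comm _ _, ?_⟩
  refine (tendsto_drift h).congr fun n => ?_
  rw [meanLength]
  congr 1
  exact tsum_congr fun x => mul_comm _ _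

lemma drift_le_meanLength {μ : PMF Γ} (h : FiniteSecondMoment μ) : drift h ≤ meanLength μ := by
  simpa [convPow_one] using mul_drift_le h 1

lemma sq_max_sub_le {s x y α β : ℝ} (hs : s ≤ x + y) :
    max (s - (α + β)) 0 ^ 2 ≤
      max (x - α) 0 ^ 2 + 2 * (max (x - α) 0 * (y - β)) + (y - β) ^ 2 := by
  have hx : x - α ≤ max (x - α) 0 := le_max_left _ _
  calc max (s - (α + β)) 0 ^ 2
      ≤ (max (x - α) 0 + (y - β)) ^ 2 := by
        rcases le_total (s - (α + β)) 0 with h | h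
        · rw [max_eq_right h, sq, zero_mul]
          exact sq_nonneg _
        · rw [max_eq_left h]
          exact pow_le_pow_left₀ h (by linarith) 2
    _ = _ := by ring

-- The cross term vanishes because `|y| - E|y|` is centred.
lemma excess_mulConv_le {a b : PMF Γ} (ha : FiniteSecondMoment a) (hb : FiniteSecondMoment b)
    (α : ℝ) : excess (mulConv a b) (α + meanLength b) ≤ excess a α + lengthVar b := by
  refine (mulConv_tsum_le a b (F := fun x => max (dist x 1 - (α + meanLength b)) 0 ^ 2)
    (Φ := fun p => max (dist p.1 1 - α) 0 ^ 2
      + 2 * (max (dist p.1 1 - α) 0 * (dist p.2 1 - meanLength b))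
      + (dist p.2 1 - meanLength b) ^ 2)
    (fun x => sq_nonneg _) (fun x y _ _ => sq_max_sub_le (dist_mul_one_le x y)) ?_).2
  have hexcess := hasSum_mul_prod (summable_excess ha α).hasSum (hasSum_wt b)
  have hvar := hasSum_mul_prod (hasSum_wt a) (summable_sq_sub hb (meanLength b)).hasSum
  have hpos : Summable fun x => wt a x * max (dist x 1 - α) 0 := by
    refine (summable_wt_mul_of_le a (G := fun x => 1 + max (dist x 1 - α) 0 ^ 2)
      (fun x => le_max_right _ _)
      (fun x _ => by nlinarith [sq_nonneg (max (dist x 1 - α) 0 - 1)]) ?_).1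
    simpa only [mul_add, mul_one] using (summable_wt a).add (summable_excess ha α)
  have hcentred : HasSum (fun y => wt b y * (dist y 1 - meanLength b)) 0 := by
    simpa only [mul_sub, one_mul, sub_self] using
      hb.hasSum_dist.sub ((hasSum_wt b).mul_right (meanLength b))
  have hcross := (hasSum_mul_prod hpos.hasSum hcentred).mul_left 2
  have hsum := (hexcess.add hcross).add hvar
  rw [mul_zero, mul_zero, add_zero, mul_one, one_mul] at hsum
  convert hsum using 1
  · funext p
    ring
  · rfl

lemma excess_convPow_le {b : PMF Γ} (hb : FiniteSecondMoment b) (k : ℕ) :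
    excess (convPow b k) (k * meanLength b) ≤ k * lengthVar b := by
  induction k with
  | zero =>
    have h0 : excess (convPow b 0) 0 = _ :=
      (hasSum_wt_pure_one fun x : Γ => max (dist x 1 - 0) 0 ^ 2).tsum_eq
    simp [h0]
  | succ k ih =>
    have h := excess_mulConv_le (hb.convPow k) hb (k * meanLength b)
    rw [convPow_succ]
    push_cast
    rw [add_mul, add_mul, one_mul, one_mul]
    linarith

lemma excess_convPow_mul_add_le {μ : PMF Γ} (h : FiniteSecondMoment μ) (m q r : ℕ) :
    excess (convPow μ (m * q + r))
        (q * meanLength (convPow μ m) + meanLength (convPow μ r)) ≤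
      q * lengthVar (convPow μ m) + lengthVar (convPow μ r) := by
  have hblocks := excess_convPow_le (h.convPow m) q
  have hremainder := excess_mulConv_le ((h.convPow m).convPow q) (h.convPow r)
    (q * meanLength (convPow μ m))
  rw [convPow_add, convPow_mul]
  linarith

-- A walk of `k = m q + r` steps consists of `q` independent blocks of `m` steps, whose mean
-- length is less than `c m` for a suitable `m`, and of a remainder.
lemma exists_excess_convPow_le {μ : PMF Γ} (h : FiniteSecondMoment μ) {c : ℝ}
    (hc : drift h < c) :
    ∃ C V : ℝ, 0 ≤ V ∧
      ∀ n k : ℕ, k ≤ n → excess (convPow μ k) (c * n + C) ≤ V * (n + 1) := by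
  obtain ⟨m, hm1, hm⟩ : ∃ m : ℕ, 1 ≤ m ∧ meanLength (convPow μ m) / m < c :=
    ((eventually_ge_atTop 1).and ((tendsto_drift h).eventually_lt_const hc)).exists
  have hm0 : (0 : ℝ) < m := by exact_mod_cast hm1
  rw [div_lt_iff₀ hm0] at hm
  set C := ∑ r ∈ Finset.range m, meanLength (convPow μ r)
  set V := ∑ r ∈ Finset.range m, lengthVar (convPow μ r)
  have hV0 : 0 ≤ V := Finset.sum_nonneg fun r _ => lengthVar_nonneg _
  have hVm : 0 ≤ lengthVar (convPow μ m) := lengthVar_nonneg _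
  refine ⟨C, lengthVar (convPow μ m) + V, by linarith, fun n k hk => ?_⟩
  obtain ⟨q, r, hr, rfl⟩ : ∃ q r, r ∈ Finset.range m ∧ m * q + r = k :=
    ⟨k / m, k % m, Finset.mem_range.2 (Nat.mod_lt _ hm1), Nat.div_add_mod k m⟩
  have hmq : (m : ℝ) * q ≤ n := by exact_mod_cast (Nat.le_add_right _ r).trans hk
  have hqn : (q : ℝ) ≤ n :=
    (le_mul_of_one_le_left q.cast_nonneg (by exact_mod_cast hm1)).trans hmq
  have hCr : meanLength (convPow μ r) ≤ C :=
    Finset.single_le_sum (f := fun r => meanLength (convPow μ r))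
      (fun r _ => meanLength_nonneg _) hr
  have hVr : lengthVar (convPow μ r) ≤ V :=
    Finset.single_le_sum (f := fun r => lengthVar (convPow μ r))
      (fun r _ => lengthVar_nonneg _) hr
  have hmean : q * meanLength (convPow μ m) ≤ c * n :=
    calc q * meanLength (convPow μ m) ≤ q * (c * m) := by gcongr
      _ = c * (m * q) := by ring
      _ ≤ c * n := mul_le_mul_of_nonneg_left hmq ((drift_nonneg h).trans hc.le)
  calc excess (convPow μ (m * q + r)) (c * n + C)
      ≤ excess (convPow μ (m * q + r)) (q * meanLength (convPow μ m) + meanLength (convPow μ r)) :=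
        excess_antitone (h.convPow _) (by linarith)
    _ ≤ q * lengthVar (convPow μ m) + lengthVar (convPow μ r) := excess_convPow_mul_add_le h m q r
    _ ≤ (lengthVar (convPow μ m) + V) * (n + 1) := by nlinarith [n.cast_nonneg (α := ℝ)]

lemma eventually_tail_convPow_le {μ : PMF Γ} (h : FiniteSecondMoment μ) {c η : ℝ}
    (hc : drift h < c) (hη : 0 < η) :
    ∀ᶠ n : ℕ in atTop, ∀ k ≤ n, tail (convPow μ k) (c * n) ≤ η := by
  obtain ⟨c', hc', hcc'⟩ := exists_between hc
  obtain ⟨C, V, hV, hexcess⟩ := exists_excess_convPow_le h hc'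
  obtain ⟨δ, hδ, rfl⟩ : ∃ δ > 0, c' + δ = c := ⟨c - c', sub_pos.2 hcc', by ring⟩
  have hcast := tendsto_natCast_atTop_atTop (R := ℝ)
  filter_upwards [eventually_ge_atTop 1, hcast.eventually_ge_atTop (2 * C / δ),
    hcast.eventually_ge_atTop (8 * V / (η * δ ^ 2))] with n hn hnC hnV k hk
  have hn0 : (1 : ℝ) ≤ n := by exact_mod_cast hn
  rw [div_le_iff₀ hδ] at hnC
  rw [div_le_iff₀ (by positivity)] at hnV
  have hgap : δ * n / 2 ≤ (c' + δ) * n - (c' * n + C) := by linarith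
  have hgap0 : 0 < δ * n / 2 := by positivity
  calc tail (convPow μ k) ((c' + δ) * n)
      ≤ excess (convPow μ k) (c' * n + C) / ((c' + δ) * n - (c' * n + C)) ^ 2 :=
        tail_le_excess_div (h.convPow k) (by linarith)
    _ ≤ V * (n + 1) / (δ * n / 2) ^ 2 := by
        gcongr
        exact hexcess n k hk
    _ ≤ η := by
        rw [div_le_iff₀ (by positivity)]
        nlinarith [mul_le_mul_of_nonneg_left hnV (by positivity : (0 : ℝ) ≤ n),
          mul_le_mul_of_nonneg_left hn0 hV]

end Moments

section Growth

variable {Γ : Type*} [Group Γ] [MetricSpace Γ]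

/-- The cardinality of the ball `B(e, R)`. -/
def ballCard (Γ : Type*) [Group Γ] [MetricSpace Γ] (R : ℝ) : ℝ :=
  ((Metric.closedBall (1 : Γ) R).ncard : ℝ)

lemma one_le_ballCard (hproper : ProperDist Γ) {R : ℝ} (hR : 0 ≤ R) : 1 ≤ ballCard Γ R := by
  have : 0 < (Metric.closedBall (1 : Γ) R).ncard :=
    (Set.ncard_pos (hproper R)).2 ⟨1, Metric.mem_closedBall_self hR⟩
  rw [ballCard]
  exact_mod_cast this

lemma volumeGrowth_nonneg (hproper : ProperDist Γ) : 0 ≤ volumeGrowth Γ := by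
  refine le_liminf_of_le (by isBoundedDefault) (Eventually.of_forall fun n => ?_)
  exact EReal.coe_nonneg.2
    (div_nonneg (Real.log_nonneg (one_le_ballCard hproper n.cast_nonneg)) n.cast_nonneg)

lemma nonneg_of_volumeGrowth_eq (hproper : ProperDist Γ) {v : ℝ}
    (hv : volumeGrowth Γ = (v : EReal)) : 0 ≤ v :=
  EReal.coe_nonneg.1 (hv ▸ volumeGrowth_nonneg hproper)

lemma frequently_log_ballCard_le {v w : ℝ} (hv : volumeGrowth Γ = (v : EReal)) (hw : v < w) :
    ∃ᶠ N : ℕ in atTop, Real.log (ballCard Γ N) ≤ w * N := by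
  have hlt : volumeGrowth Γ < (w : EReal) := hv ▸ EReal.coe_lt_coe_iff.2 hw
  refine ((frequently_lt_of_liminf_lt (by isBoundedDefault) hlt).and_eventually
    (eventually_ge_atTop 1)).mono fun N hN => ?_
  have hN0 : (0 : ℝ) < N := by exact_mod_cast hN.2
  exact ((div_lt_iff₀ hN0).1 (EReal.coe_lt_coe_iff.1 hN.1)).le

lemma frequently_exists_log_ballCard_le (hproper : ProperDist Γ) {v c ε : ℝ}
    (hv : volumeGrowth Γ = (v : EReal)) (hc : 0 < c) (hε : 0 < ε) :
    ∃ᶠ n : ℕ in atTop, ∃ R, c * n ≤ R ∧ Real.log (ballCard Γ R) ≤ (v * c + ε) * n := by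
  have hv0 := nonneg_of_volumeGrowth_eq hproper hv
  obtain ⟨w, hvw, hw⟩ : ∃ w, v < w ∧ w * c < v * c + ε :=
    ⟨v + ε / (2 * c), by simp only [lt_add_iff_pos_right]; positivity, by field_simp; linarith⟩
  have hfloor : Tendsto (fun N : ℕ => ⌊(N : ℝ) / c⌋₊) atTop atTop :=
    tendsto_nat_floor_atTop.comp (tendsto_natCast_atTop_atTop.atTop_div_const hc)
  have hlarge : ∀ᶠ n : ℕ in atTop, w * c / (v * c + ε - w * c) ≤ n :=
    tendsto_natCast_atTop_atTop.eventually_ge_atTop _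
  refine hfloor.frequently (((frequently_log_ballCard_le hv hvw).and_eventually
    (hfloor.eventually hlarge)).mono fun N ⟨hN, hlargeN⟩ => ⟨N, ?_, hN.trans ?_⟩)
  · rw [mul_comm, ← le_div_iff₀ hc]
    exact Nat.floor_le (by positivity)
  · have hfloorN := (Nat.lt_floor_add_one ((N : ℝ) / c)).le
    rw [div_le_iff₀ hc] at hfloorN
    rw [div_le_iff₀ (by linarith)] at hlargeN
    nlinarith

end Growth

section Entropy

section PMF

variable {α : Type*}

lemma negMulLog_le_tangent {q c : ℝ} (hq : 0 ≤ q) (hc : 0 < c) :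
    Real.negMulLog q ≤ q * -Real.log c + (c - q) := by
  rcases hq.eq_or_lt with rfl | hq
  · simp [hc.le]
  · have h := Real.log_le_sub_one_of_pos (div_pos hc hq)
    rw [Real.log_div hc.ne' hq.ne'] at h
    have := mul_le_mul_of_nonneg_left h hq.le
    have hexpand : q * (c / q - 1) = c - q := by field_simp
    rw [Real.negMulLog]
    linarith

lemma sum_negMulLog_wt_le (a : PMF α) {s : Finset α} (hs : s.Nonempty) :
    ∑ x ∈ s, Real.negMulLog (wt a x) ≤ Real.log s.card + 1 := by
  have hcard : (0 : ℝ) < s.card := by exact_mod_cast hs.card_pos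
  have h1 : ∑ x ∈ s, wt a x ≤ 1 :=
    sum_le_hasSum s (fun x _ => wt_nonneg a x) (hasSum_wt a)
  have h0 : 0 ≤ ∑ x ∈ s, wt a x := Finset.sum_nonneg fun x _ => wt_nonneg a x
  have hlog : 0 ≤ Real.log s.card := Real.log_nonneg (by exact_mod_cast hs.card_pos)
  calc ∑ x ∈ s, Real.negMulLog (wt a x)
      ≤ ∑ x ∈ s, (wt a x * -Real.log ((s.card : ℝ)⁻¹) + ((s.card : ℝ)⁻¹ - wt a x)) :=
        Finset.sum_le_sum fun x _ => negMulLog_le_tangent (wt_nonneg a x) (inv_pos.2 hcard)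
    _ = (∑ x ∈ s, wt a x) * Real.log s.card + (1 - ∑ x ∈ s, wt a x) := by
        rw [Finset.sum_add_distrib, Finset.sum_sub_distrib, ← Finset.sum_mul, Real.log_inv,
          neg_neg, Finset.sum_const, nsmul_eq_mul, mul_inv_cancel₀ hcard.ne']
    _ ≤ Real.log s.card + 1 := by nlinarith

/-- The expected excess of the information function `-log a` over `K`; it plays for the entropy the
role of `excess` for the length. -/
def infoExcess (a : PMF α) (K : ℝ) : ℝ :=
  ∑' x, wt a x * max (-Real.log (wt a x) - K) 0

/-- The entropy of a probability mass function. -/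
def entropy (a : PMF α) : ℝ := ∑' x, Real.negMulLog (wt a x)

lemma wt_mul_max_neg_log (a : PMF α) (x : α) :
    wt a x * max (-Real.log (wt a x) - 0) 0 = Real.negMulLog (wt a x) := by
  rw [sub_zero, max_eq_left, Real.negMulLog]
  · ring
  · exact neg_nonneg.2 (Real.log_nonpos (wt_nonneg a x) (wt_le_one a x))

lemma infoExcess_zero (a : PMF α) : infoExcess a 0 = entropy a :=
  tsum_congr (wt_mul_max_neg_log a)

lemma summable_infoExcess {a : PMF α} (ha : FiniteEntropy a) {K : ℝ} (hK : 0 ≤ K) :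
    Summable fun x => wt a x * max (-Real.log (wt a x) - K) 0 := by
  have ha' : Summable fun x => wt a x * max (-Real.log (wt a x) - 0) 0 :=
    ha.congr fun x => (wt_mul_max_neg_log a x).symm
  exact (summable_wt_mul_of_le a (fun x => le_max_right _ _)
    (fun x _ => max_le_max (by linarith) le_rfl) ha').1

lemma tendsto_infoExcess {a : PMF α} (ha : FiniteEntropy a) :
    Tendsto (fun K : ℕ => infoExcess a K) atTop (𝓝 0) := by
  have h : Tendsto (fun K : ℕ => ∑' x, wt a x * max (-Real.log (wt a x) - K) 0) atTop
      (𝓝 (∑' _ : α, (0 : ℝ))) := by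
    refine tendsto_tsum_of_dominated_convergence (bound := fun x => Real.negMulLog (wt a x))
      ha (fun x => ?_) (Eventually.of_forall fun K x => ?_)
    · refine tendsto_const_nhds.congr' ?_
      filter_upwards [tendsto_natCast_atTop_atTop.eventually_ge_atTop (-Real.log (wt a x))]
        with K hK
      rw [max_eq_right (by linarith), mul_zero]
    · have hn : 0 ≤ wt a x * max (-Real.log (wt a x) - K) 0 :=
        mul_nonneg (wt_nonneg a x) (le_max_right _ _)
      rw [Real.norm_eq_abs, abs_of_nonneg hn, ← wt_mul_max_neg_log]
      refine mul_le_mul_of_nonneg_left (max_le_max ?_ le_rfl) (wt_nonneg a x)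
      have : (0 : ℝ) ≤ K := K.cast_nonneg
      linarith
  rwa [tsum_zero] at h

lemma entropy_nonneg (a : PMF α) : 0 ≤ entropy a :=
  tsum_nonneg fun x => Real.negMulLog_nonneg (wt_nonneg a x) (wt_le_one a x)

end PMF

section Convolution

variable {Γ : Type*} [Group Γ]

lemma infoExcess_mulConv_le {a b : PMF Γ} (ha : FiniteEntropy a) (hb : FiniteEntropy b)
    {K L : ℝ} (hK : 0 ≤ K) (hL : 0 ≤ L) :
    (Summable fun x => wt (mulConv a b) x *
      max (-Real.log (wt (mulConv a b) x) - (K + L)) 0) ∧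
      infoExcess (mulConv a b) (K + L) ≤ infoExcess a K + infoExcess b L := by
  refine mulConv_tsum_le_add a b
    (F := fun x => max (-Real.log (wt (mulConv a b) x) - (K + L)) 0)
    (G := fun x => max (-Real.log (wt a x) - K) 0)
    (H := fun x => max (-Real.log (wt b x) - L) 0) (fun x => le_max_right _ _)
    (fun x y hx hy => ?_) (summable_infoExcess ha hK) (summable_infoExcess hb hL)
  have h := Real.log_le_log (mul_pos hx hy) (mul_wt_le_wt_mulConv a b x y)
  rw [Real.log_mul hx.ne' hy.ne'] at h
  have h1 : -Real.log (wt a x) - K ≤ max (-Real.log (wt a x) - K) 0 := le_max_left _ _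
  have h2 : -Real.log (wt b y) - L ≤ max (-Real.log (wt b y) - L) 0 := le_max_left _ _
  exact max_le (by linarith) (add_nonneg (le_max_right _ _) (le_max_right _ _))

lemma FiniteEntropy.mulConv {a b : PMF Γ} (ha : FiniteEntropy a) (hb : FiniteEntropy b) :
    FiniteEntropy (mulConv a b) := by
  have h := (infoExcess_mulConv_le ha hb le_rfl le_rfl).1
  rw [add_zero] at h
  exact h.congr fun x => wt_mul_max_neg_log _ x

lemma entropy_mulConv_le {a b : PMF Γ} (ha : FiniteEntropy a) (hb : FiniteEntropy b) :
    entropy (mulConv a b) ≤ entropy a + entropy b := by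
  have h := (infoExcess_mulConv_le ha hb le_rfl le_rfl).2
  rwa [add_zero, infoExcess_zero, infoExcess_zero, infoExcess_zero] at h

lemma log_wt_pure_one (x : Γ) : Real.log (wt (PMF.pure (1 : Γ)) x) = 0 := by
  classical
  rw [wt_pure_one]
  split_ifs <;> simp

lemma FiniteEntropy.convPow {μ : PMF Γ} (h : FiniteEntropy μ) (n : ℕ) :
    FiniteEntropy (convPow μ n) := by
  induction n with
  | zero =>
    refine summable_zero.congr fun x => ?_
    change 0 = Real.negMulLog (wt (PMF.pure (1 : Γ)) x)
    simp [Real.negMulLog, log_wt_pure_one]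
  | succ n ih => exact ih.mulConv h

lemma infoExcess_convPow_le {μ : PMF Γ} (h : FiniteEntropy μ) {K : ℝ} (hK : 0 ≤ K) (n : ℕ) :
    infoExcess (convPow μ n) (n * K) ≤ n * infoExcess μ K := by
  induction n with
  | zero =>
    change infoExcess (PMF.pure (1 : Γ)) _ ≤ _
    simp [infoExcess, log_wt_pure_one]
  | succ n ih =>
    have := (infoExcess_mulConv_le (h.convPow n) h (K := n * K) (by positivity) hK).2
    rw [← convPow_succ] at this
    push_cast
    rw [add_mul, add_mul, one_mul, one_mul]
    linarith

lemma subadditive_entropy {μ : PMF Γ} (h : FiniteEntropy μ) :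
    Subadditive fun n => entropy (convPow μ n) := fun m n => by
  simp only [convPow_add]
  exact entropy_mulConv_le (h.convPow m) (h.convPow n)

lemma bddBelow_entropy_div (μ : PMF Γ) :
    BddBelow (Set.range fun n : ℕ => entropy (convPow μ n) / n) :=
  ⟨0, by
    rintro _ ⟨n, rfl⟩
    exact div_nonneg (entropy_nonneg _) n.cast_nonneg⟩

/-- The asymptotic entropy `h = lim H(μ^{*n}) / n`, as the limit of a subadditive sequence. -/
def asymptoticEntropy {μ : PMF Γ} (h : FiniteEntropy μ) : ℝ := (subadditive_entropy h).lim

lemma isAsymptoticEntropy_asymptoticEntropy {μ : PMF Γ} (h : FiniteEntropy μ) :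
    IsAsymptoticEntropy μ (asymptoticEntropy h) :=
  ⟨h.convPow, (subadditive_entropy h).tendsto_lim (bddBelow_entropy_div μ)⟩

lemma mul_asymptoticEntropy_le {μ : PMF Γ} (h : FiniteEntropy μ) {n : ℕ} (hn : n ≠ 0) :
    n * asymptoticEntropy h ≤ entropy (convPow μ n) := by
  rw [mul_comm, ← le_div_iff₀ (by positivity)]
  exact (subadditive_entropy h).lim_le_div (bddBelow_entropy_div μ) hn

end Convolution

section Balls

variable {Γ : Type*} [Group Γ] [MetricSpace Γ]

lemma ballCard_eq_card (hproper : ProperDist Γ) (R : ℝ) :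
    ballCard Γ R = (hproper R).toFinset.card := by
  rw [ballCard, Set.ncard_eq_toFinset_card _ (hproper R)]

lemma mem_toFinset_ball (hproper : ProperDist Γ) {R : ℝ} {x : Γ} :
    x ∈ (hproper R).toFinset ↔ dist x 1 ≤ R := by
  rw [Set.Finite.mem_toFinset, Metric.mem_closedBall]

lemma hasSum_ite_ball (hproper : ProperDist Γ) (F : Γ → ℝ) (R : ℝ) :
    HasSum (fun x => if dist x 1 ≤ R then F x else 0) (∑ x ∈ (hproper R).toFinset, F x) := by
  rw [← Finset.sum_congr rfl fun x hx => if_pos ((mem_toFinset_ball hproper).1 hx)]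
  exact hasSum_sum_of_ne_finset_zero fun x hx => if_neg (mt (mem_toFinset_ball hproper).2 hx)

lemma tsum_wt_mul_le_log_ballCard_add (hproper : ProperDist Γ) {a : PMF Γ} {F G : Γ → ℝ} {R : ℝ}
    (hR : 0 ≤ R) (hF : Summable fun x => wt a x * F x) (hG : Summable fun x => wt a x * G x)
    (hball : ∀ x, 0 < wt a x → dist x 1 ≤ R → F x ≤ -Real.log (wt a x) + G x)
    (hcompl : ∀ x, R < dist x 1 → F x ≤ G x) :
    ∑' x, wt a x * F x ≤ Real.log (ballCard Γ R) + 1 + ∑' x, wt a x * G x := by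
  have hsum := (hasSum_ite_ball hproper (fun x => Real.negMulLog (wt a x)) R).add hG.hasSum
  refine (hasSum_le (fun x => ?_) hF.hasSum hsum).trans ?_
  · rcases (wt_nonneg a x).eq_or_lt with hx | hx
    · simp [← hx]
    split_ifs with hxR
    · have := mul_le_mul_of_nonneg_left (hball x hx hxR) hx.le
      rw [Real.negMulLog]
      linarith
    · rw [zero_add]
      exact mul_le_mul_of_nonneg_left (hcompl x (not_le.1 hxR)) hx.le
  · have hne : (hproper R).toFinset.Nonempty :=
      ⟨1, (mem_toFinset_ball hproper).2 (by rwa [dist_self])⟩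
    rw [ballCard_eq_card hproper]
    gcongr
    exact sum_negMulLog_wt_le a hne

lemma entropy_le_log_ballCard (hproper : ProperDist Γ) {a : PMF Γ} (ha : FiniteEntropy a)
    {R K : ℝ} (hR : 0 ≤ R) (hK : 0 ≤ K) :
    entropy a ≤ Real.log (ballCard Γ R) + 1 + (K * tail a R + infoExcess a K) := by
  have hG : HasSum (fun x => wt a x * (K * (if R < dist x 1 then 1 else 0) +
      max (-Real.log (wt a x) - K) 0)) (K * tail a R + infoExcess a K) :=
    (((summable_tail a R).hasSum.mul_left K).add
      (summable_infoExcess ha hK).hasSum).congr_fun fun x => by ring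
  have hF : (fun x => wt a x * -Real.log (wt a x)) = fun x => Real.negMulLog (wt a x) :=
    funext fun x => by rw [Real.negMulLog]; ring
  rw [entropy, ← hF, ← hG.tsum_eq]
  refine tsum_wt_mul_le_log_ballCard_add hproper hR (hF ▸ ha) hG.summable
    (fun x _ hx => ?_) fun x hx => ?_
  · rw [if_neg (not_lt.2 hx), mul_zero, zero_add]
    exact le_add_of_nonneg_right (le_max_right _ _)
  · rw [if_pos hx, mul_one, ← sub_le_iff_le_add']
    exact le_max_left _ _

lemma asymptoticEntropy_le_mul_drift_add [IsIsometricSMul Γ Γ] (hproper : ProperDist Γ) {v : ℝ}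
    (hv : volumeGrowth Γ = (v : EReal)) {μ : PMF Γ} (hmom : FiniteSecondMoment μ)
    (hent : FiniteEntropy μ) {ε : ℝ} (hε : 0 < ε) :
    asymptoticEntropy hent ≤ v * (drift hmom + ε) + 4 * ε := by
  obtain ⟨K, hK⟩ := ((tendsto_infoExcess hent).eventually_le_const hε).exists
  have hc : drift hmom < drift hmom + ε := lt_add_of_pos_right _ hε
  obtain ⟨n, ⟨R, hcR, hball⟩, htail, hn, hn0⟩ :=
    ((frequently_exists_log_ballCard_le hproper hv ((drift_nonneg hmom).trans_lt hc)
      hε).and_eventually ((eventually_tail_convPow_le hmom hc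
        (div_pos hε (Nat.cast_add_one_pos K))).and
      ((tendsto_natCast_atTop_atTop.eventually_ge_atTop (1 / ε)).and
        (eventually_gt_atTop 0)))).exists
  have hnpos : (0 : ℝ) < n := Nat.cast_pos.2 hn0
  have hKtail : (K : ℝ) * tail (convPow μ n) R ≤ ε := by
    have := (tail_antitone _ hcR).trans (htail n le_rfl)
    rw [le_div_iff₀ (Nat.cast_add_one_pos K)] at this
    linarith [tail_nonneg (convPow μ n) R]
  have hR : 0 ≤ R := (mul_nonneg ((drift_nonneg hmom).trans hc.le) hnpos.le).trans hcR
  rw [div_le_iff₀ hε] at hn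
  refine le_of_mul_le_mul_left ?_ hnpos
  calc n * asymptoticEntropy hent ≤ entropy (convPow μ n) :=
        mul_asymptoticEntropy_le hent hn0.ne'
    _ ≤ Real.log (ballCard Γ R) + 1 +
        (n * K * tail (convPow μ n) R + infoExcess (convPow μ n) (n * K)) :=
      entropy_le_log_ballCard hproper (hent.convPow n) hR (by positivity)
    _ ≤ (v * (drift hmom + ε) + ε) * n + n * ε + (n * ε + n * ε) := by
      have hinfo := infoExcess_convPow_le hent K.cast_nonneg n
      rw [mul_assoc (n : ℝ)]
      gcongr
      exact hinfo.trans (by gcongr)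
    _ = n * (v * (drift hmom + ε) + 4 * ε) := by ring

lemma asymptoticEntropy_le_drift_mul [IsIsometricSMul Γ Γ] (hproper : ProperDist Γ) {v : ℝ}
    (hv : volumeGrowth Γ = (v : EReal)) {μ : PMF Γ} (hmom : FiniteSecondMoment μ)
    (hent : FiniteEntropy μ) : asymptoticEntropy hent ≤ drift hmom * v := by
  have hlim : Tendsto (fun ε : ℝ => v * (drift hmom + ε) + 4 * ε) (𝓝[>] 0)
      (𝓝 (drift hmom * v)) :=
    (Continuous.tendsto' (by fun_prop) 0 _ (by ring)).mono_left nhdsWithin_le_nhds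
  exact ge_of_tendsto hlim (eventually_nhdsWithin_of_forall fun ε hε =>
    asymptoticEntropy_le_mul_drift_add hproper hv hmom hent hε)

lemma summable_exp_neg_ceil_dist (hproper : ProperDist Γ) {C : ℝ}
    (hgrowth : ∀ n : ℕ, ballCard Γ n ≤ Real.exp (C * n)) :
    Summable fun g : Γ => Real.exp (-(C + 1) * ⌈dist g 1⌉₊) := by
  classical
  refine summable_of_sum_le (c := ∑' n : ℕ, Real.exp (-n)) (fun g => (Real.exp_pos _).le)
    fun s => ?_
  have hsphere : ∀ n : ℕ, ∑ g ∈ s with ⌈dist g 1⌉₊ = n, Real.exp (-(C + 1) * ⌈dist g 1⌉₊) ≤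
      Real.exp (-n) := fun n => by
    have hsub : {g ∈ s | ⌈dist g 1⌉₊ = n} ⊆ (hproper n).toFinset := fun g hg =>
      (mem_toFinset_ball hproper).2 (Nat.ceil_le.1 (Finset.mem_filter.1 hg).2.le)
    calc ∑ g ∈ s with ⌈dist g 1⌉₊ = n, Real.exp (-(C + 1) * ⌈dist g 1⌉₊)
        = ({g ∈ s | ⌈dist g 1⌉₊ = n} : Finset Γ).card * Real.exp (-(C + 1) * n) := by
          rw [← nsmul_eq_mul, ← Finset.sum_const]
          exact Finset.sum_congr rfl fun g hg => by rw [(Finset.mem_filter.1 hg).2]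
      _ ≤ Real.exp (C * n) * Real.exp (-(C + 1) * n) := by
          gcongr
          refine le_trans ?_ (hgrowth n)
          rw [ballCard_eq_card hproper]
          exact_mod_cast Finset.card_le_card hsub
      _ = Real.exp (-n) := by
          rw [← Real.exp_add]
          ring_nf
  rw [← Finset.sum_fiberwise_of_maps_to fun g hg => Finset.mem_image_of_mem
    (fun g : Γ => ⌈dist g 1⌉₊) hg]
  exact (Finset.sum_le_sum fun n _ => hsphere n).trans
    (Real.summable_exp_neg_nat.sum_le_tsum _ fun n _ => (Real.exp_pos _).le)

lemma finiteEntropy_of_growth (hproper : ProperDist Γ) (hgrowth : AtMostExponentialGrowth Γ)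
    {μ : PMF Γ} (hmom : FiniteSecondMoment μ) : FiniteEntropy μ := by
  obtain ⟨C, hC⟩ := hgrowth
  have hC0 : 0 ≤ C := by
    simpa using (one_le_ballCard hproper (Nat.cast_nonneg 1)).trans (hC 1 le_rfl)
  have hC' : ∀ n : ℕ, ballCard Γ n ≤ Real.exp (C * n) := fun n => by
    rcases n.eq_zero_or_pos with rfl | hn
    · simp [ballCard]
    · exact hC n hn
  have hsum := ((hmom.summable_dist.add (summable_wt μ)).mul_left (C + 1)).add
    (summable_exp_neg_ceil_dist hproper hC')
  refine Summable.of_nonneg_of_le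
    (fun x => Real.negMulLog_nonneg (wt_nonneg μ x) (wt_le_one μ x)) (fun x => ?_) hsum
  have hceil := mul_le_mul_of_nonneg_left (Nat.ceil_lt_add_one (dist_nonneg (x := x) (y := 1))).le
    (mul_nonneg (wt_nonneg μ x) (by positivity : 0 ≤ C + 1))
  have := negMulLog_le_tangent (wt_nonneg μ x) (Real.exp_pos (-(C + 1) * ⌈dist x 1⌉₊))
  rw [Real.log_exp] at this
  exact this.trans (by linarith [wt_nonneg μ x])

end Balls

end Entropy

section GeometricTime

lemma wt_bind {ι α : Type*} (b : PMF ι) (f : ι → PMF α) (x : α) :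
    wt (b.bind f) x = ∑' j, wt b j * wt (f j) x := by
  rw [wt, PMF.bind_apply, ENNReal.tsum_toReal_eq fun j =>
    ENNReal.mul_ne_top (b.apply_ne_top j) ((f j).apply_ne_top x)]
  simp only [ENNReal.toReal_mul, wt]

lemma hasSum_bind {ι α : Type*} (b : PMF ι) (f : ι → PMF α) {F : α → ℝ} (hF : ∀ x, 0 ≤ F x)
    (hf : ∀ j, Summable fun x => wt (f j) x * F x)
    (hb : Summable fun j => wt b j * ∑' x, wt (f j) x * F x) :
    HasSum (fun x => wt (b.bind f) x * F x) (∑' j, wt b j * ∑' x, wt (f j) x * F x) := by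
  have hpair : HasSum (fun p : ι × α => wt b p.1 * (wt (f p.1) p.2 * F p.2))
      (∑' j, wt b j * ∑' x, wt (f j) x * F x) := by
    have hs : Summable fun p : ι × α => wt b p.1 * (wt (f p.1) p.2 * F p.2) := by
      refine (summable_prod_of_nonneg fun p => ?_).2 ⟨fun j => (hf j).mul_left (wt b j), ?_⟩
      · exact mul_nonneg (wt_nonneg _ _) (mul_nonneg (wt_nonneg _ _) (hF _))
      · exact hb.congr fun j => tsum_mul_left.symm
    convert hs.hasSum using 1
    rw [hs.tsum_prod]
    exact tsum_congr fun j => tsum_mul_left.symm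
  have hswap := (Equiv.prodComm α ι).hasSum_iff.2 hpair
  convert hswap.prod_fiberwise fun x => (hswap.summable.prod_factor x).hasSum using 2 with x
  rw [wt_bind, ← tsum_mul_right]
  exact tsum_congr fun j => mul_assoc _ _ _

/-- The geometric law `j ↦ 2^{-(j+1)}` on `ℕ`. -/
def geomLaw : PMF ℕ :=
  ⟨fun j => (2 : ENNReal)⁻¹ ^ (j + 1), by
    have h : ∑' j : ℕ, (2 : ENNReal)⁻¹ ^ (j + 1) = 1 := by
      rw [ENNReal.tsum_geometric_add_one, ENNReal.one_sub_inv_two, inv_inv,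
        ENNReal.inv_mul_cancel two_ne_zero ENNReal.ofNat_ne_top]
    exact h ▸ ENNReal.summable.hasSum⟩

lemma wt_geomLaw (j : ℕ) : wt geomLaw j = (1 / 2) ^ (j + 1) := by
  change ((2 : ENNReal)⁻¹ ^ (j + 1)).toReal = _
  simp

variable {Γ : Type*} [Group Γ]

/-- The law of the walk at time `n` plus an independent geometric time. The
recursion `wt_delayed` closes the telescoping sum over the times `k < n`. -/
def delayed (μ : PMF Γ) (n : ℕ) : PMF Γ := geomLaw.bind fun j => convPow μ (n + j)

lemma wt_delayed (μ : PMF Γ) (n : ℕ) (x : Γ) :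
    wt (delayed μ n) x = (wt (convPow μ n) x + wt (delayed μ (n + 1)) x) / 2 := by
  have hs : Summable fun j => wt geomLaw j * wt (convPow μ (n + j)) x :=
    summable_wt_mul_of_abs_le _ (C := 1) fun j => by
      rw [abs_of_nonneg (wt_nonneg _ _)]
      exact wt_le_one _ _
  rw [delayed, delayed, wt_bind, wt_bind, hs.tsum_eq_zero_add, wt_geomLaw, add_div, add_zero,
    ← tsum_div_const]
  congr 1
  · ring
  · refine tsum_congr fun j => ?_
    rw [wt_geomLaw, wt_geomLaw, Nat.add_right_comm n 1 j, add_assoc n]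
    ring

lemma mulConv_delayed (μ : PMF Γ) (n : ℕ) : mulConv (delayed μ n) μ = delayed μ (n + 1) := by
  simp only [delayed, mulConv, PMF.bind_bind, Nat.add_right_comm n 1]
  rfl

lemma delayed_eq_mulConv (μ : PMF Γ) (n : ℕ) :
    delayed μ n = mulConv (convPow μ n) (delayed μ 0) := by
  simp only [delayed, convPow_add, zero_add, mulConv, PMF.map_bind]
  rw [PMF.bind_comm]

variable [MetricSpace Γ]

lemma tail_le_meanLength_div {a : PMF Γ} (h : Summable fun x => wt a x * dist x 1) {R : ℝ}
    (hR : 0 < R) : tail a R ≤ meanLength a / R := by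
  rw [meanLength, ← tsum_div_const]
  refine (summable_tail a R).tsum_le_tsum (fun x => ?_) (h.div_const R)
  rw [mul_div_assoc]
  refine mul_le_mul_of_nonneg_left ?_ (wt_nonneg a x)
  split_ifs with hx
  · rw [one_le_div hR]
    exact hx.le
  · positivity

variable [IsIsometricSMul Γ Γ]

lemma meanLength_convPow_le {μ : PMF Γ} (h : FiniteSecondMoment μ) (n : ℕ) :
    meanLength (convPow μ n) ≤ n * meanLength μ := by
  have h0 : meanLength (convPow μ 0) = 0 :=
    (hasSum_wt_pure_one fun x : Γ => dist x 1).tsum_eq.trans (dist_self 1)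
  simpa [h0, convPow_one] using (subadditive_meanLength h).apply_mul_add_le n 1 0

lemma summable_geomLaw_mul_meanLength {μ : PMF Γ} (h : FiniteSecondMoment μ) (n : ℕ) :
    Summable fun j => wt geomLaw j * meanLength (convPow μ (n + j)) := by
  have hgeom : Summable fun j : ℕ => wt geomLaw j * ((n + j : ℕ) * meanLength μ) := by
    have h0 := (summable_geometric_two.mul_right (n * meanLength μ / 2)).add
      ((summable_pow_mul_geometric_of_norm_lt_one 1
        (by norm_num : ‖(1 / 2 : ℝ)‖ < 1)).mul_right (meanLength μ / 2))
    refine h0.congr fun j => ?_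
    rw [wt_geomLaw]
    push_cast
    ring
  exact Summable.of_nonneg_of_le
    (fun j => mul_nonneg (wt_nonneg _ _) (meanLength_nonneg _))
    (fun j => mul_le_mul_of_nonneg_left (meanLength_convPow_le h _) (wt_nonneg _ _)) hgeom

lemma hasSum_dist_delayed {μ : PMF Γ} (h : FiniteSecondMoment μ) (n : ℕ) :
    HasSum (fun x => wt (delayed μ n) x * dist x 1)
      (∑' j, wt geomLaw j * meanLength (convPow μ (n + j))) :=
  hasSum_bind _ _ (fun _ => dist_nonneg) (fun _ => (h.convPow _).summable_dist)
    (summable_geomLaw_mul_meanLength h n)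

lemma mul_drift_le_meanLength_delayed {μ : PMF Γ} (h : FiniteSecondMoment μ) (n : ℕ) :
    n * drift h ≤ meanLength (delayed μ n) := by
  have hconst := (hasSum_wt geomLaw).mul_right (n * drift h)
  rw [one_mul] at hconst
  rw [meanLength, (hasSum_dist_delayed h n).tsum_eq]
  refine hasSum_le (fun j => mul_le_mul_of_nonneg_left ?_ (wt_nonneg _ _)) hconst
    (summable_geomLaw_mul_meanLength h n).hasSum
  refine le_trans ?_ (mul_drift_le h (n + j))
  gcongr
  · exact drift_nonneg h
  · exact Nat.le_add_right n j

lemma tail_delayed_le (μ : PMF Γ) (n : ℕ) (R R' : ℝ) :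
    tail (delayed μ n) (R + R') ≤ tail (convPow μ n) R + tail (delayed μ 0) R' := by
  rw [delayed_eq_mulConv]
  refine (mulConv_tsum_le_add _ _ (fun x => by split_ifs <;> simp) (fun x y _ _ => ?_)
    (summable_tail _ R) (summable_tail _ R')).2
  have := dist_mul_one_le x y
  split_ifs <;> norm_num
  linarith

lemma eventually_tail_delayed_le {μ : PMF Γ} (h : FiniteSecondMoment μ) {c η : ℝ}
    (hc : drift h < c) (hη : 0 < η) :
    ∀ᶠ n : ℕ in atTop, tail (delayed μ n) (c * n) ≤ η := by
  obtain ⟨c', hc', hcc'⟩ := exists_between hc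
  filter_upwards [eventually_tail_convPow_le h hc' (half_pos hη), eventually_gt_atTop 0,
    tendsto_natCast_atTop_atTop.eventually_ge_atTop
      (meanLength (delayed μ 0) / ((c - c') * (η / 2)))] with n htail hn0 hn
  have hgap : 0 < c - c' := sub_pos.2 hcc'
  have hpos : 0 < (c - c') * n := mul_pos hgap (Nat.cast_pos.2 hn0)
  have hdelay : tail (delayed μ 0) ((c - c') * n) ≤ η / 2 := by
    refine (tail_le_meanLength_div (hasSum_dist_delayed h 0).summable hpos).trans ?_
    rw [div_le_iff₀ (by positivity)] at hn ⊢
    linarith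
  calc tail (delayed μ n) (c * n) = tail (delayed μ n) (c' * n + (c - c') * n) := by ring_nf
    _ ≤ tail (convPow μ n) (c' * n) + tail (delayed μ 0) ((c - c') * n) := tail_delayed_le _ _ _ _
    _ ≤ η := by linarith [htail n le_rfl]

end GeometricTime

section Parts

variable {Γ : Type*} [Group Γ]

/-- The reversal `(x, γ) ↦ (xγ, γ⁻¹)` of edges. -/
def edgeFlip (Γ : Type*) [Group Γ] : Γ × Γ ≃ Γ × Γ where
  toFun p := (p.1 * p.2, p.2⁻¹)
  invFun p := (p.1 * p.2, p.2⁻¹)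
  left_inv p := by simp
  right_inv p := by simp

/-- The shear `(x, γ) ↦ (xγ, γ)`. -/
def edgeShear (Γ : Type*) [Group Γ] : Γ × Γ ≃ Γ × Γ where
  toFun p := (p.1 * p.2, p.2)
  invFun p := (p.1 * p.2⁻¹, p.2)
  left_inv p := by simp
  right_inv p := by simp

lemma hasSum_edge {f F : Γ → ℝ} {s t : ℝ} (hf : HasSum f s) (hF : HasSum F t) :
    HasSum (fun p : Γ × Γ => f p.2 * ((F p.1 + F (p.1 * p.2)) / 2)) (s * t) := by
  have h1 : HasSum (fun p : Γ × Γ => f p.2 * F p.1) (s * t) := by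
    simpa only [mul_comm] using hasSum_mul_prod hF hf
  have h2 : HasSum (fun p : Γ × Γ => f p.2 * F (p.1 * p.2)) (s * t) :=
    (edgeShear Γ).hasSum_iff.2 h1
  have h := (h1.add h2).div_const 2
  rw [add_self_div_two] at h
  exact h.congr_fun fun p => by ring

lemma hasSum_parts {μ : PMF Γ} (hsymm : IsSymmetric μ) {u F : Γ → ℝ} {s : ℝ}
    (h : HasSum (fun p : Γ × Γ => u p.1 * wt μ p.2 * (F (p.1 * p.2) - F p.1)) s) :
    HasSum (fun p : Γ × Γ =>
      wt μ p.2 * ((u p.1 - u (p.1 * p.2)) * (F (p.1 * p.2) - F p.1) / 2)) s := by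
  have h2 : HasSum (fun p : Γ × Γ =>
      u (p.1 * p.2) * wt μ p.2 * (F p.1 - F (p.1 * p.2))) s := by
    have := (edgeFlip Γ).hasSum_iff.2 h
    simpa [Function.comp_def, edgeFlip, hsymm.wt_inv] using this
  have h3 := (h.add h2).div_const 2
  rw [add_self_div_two] at h3
  exact h3.congr_fun fun p => by ring

/-- The density of the average of the laws of the walk at the times `k < n` and of the delayed law
at time `n`. Its increment under one step is `(delayed μ n - δ_1) / (n + 1)`. -/
def occupation (μ : PMF Γ) (n : ℕ) (x : Γ) : ℝ :=
  (∑ k ∈ Finset.range n, wt (convPow μ k) x + wt (delayed μ n) x) / (n + 1)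

lemma occupation_nonneg (μ : PMF Γ) (n : ℕ) (x : Γ) : 0 ≤ occupation μ n x :=
  div_nonneg (add_nonneg (Finset.sum_nonneg fun _ _ => wt_nonneg _ _) (wt_nonneg _ _))
    (by positivity)

lemma wt_delayed_le_occupation (μ : PMF Γ) (n : ℕ) (x : Γ) :
    wt (delayed μ n) x / (n + 1) ≤ occupation μ n x := by
  rw [occupation]
  gcongr
  exact le_add_of_nonneg_left (Finset.sum_nonneg fun _ _ => wt_nonneg _ _)

lemma hasSum_occupation_mul (μ : PMF Γ) (n : ℕ) {F : Γ → ℝ}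
    (hp : ∀ k, Summable fun x => wt (convPow μ k) x * F x)
    (hq : Summable fun x => wt (delayed μ n) x * F x) :
    HasSum (fun x => occupation μ n x * F x)
      ((∑ k ∈ Finset.range n, ∑' x, wt (convPow μ k) x * F x +
        ∑' x, wt (delayed μ n) x * F x) / (n + 1)) := by
  refine (((hasSum_sum fun k (_ : k ∈ Finset.range n) => (hp k).hasSum).add
    hq.hasSum).div_const (n + 1 : ℝ)).congr_fun fun x => ?_
  rw [occupation, ← Finset.sum_mul]
  ring

lemma hasSum_occupation (μ : PMF Γ) (n : ℕ) : HasSum (occupation μ n) 1 := by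
  have h := hasSum_occupation_mul μ n (F := fun _ => 1)
    (fun k => by simpa using summable_wt _) (by simpa using summable_wt _)
  simp only [mul_one, (hasSum_wt _).tsum_eq, Finset.sum_const, Finset.card_range,
    nsmul_eq_mul] at h
  rwa [div_self (by positivity)] at h

lemma occupation_le_one (μ : PMF Γ) (n : ℕ) (x : Γ) : occupation μ n x ≤ 1 :=
  le_hasSum (hasSum_occupation μ n) x fun y _ => occupation_nonneg μ n y

variable [MetricSpace Γ]

lemma summable_wt_mul_of_linear {a : PMF Γ} (ha : Summable fun x => wt a x * dist x 1)
    {F : Γ → ℝ} {C : ℝ} (hF : ∀ x, |F x| ≤ C * (1 + dist x 1)) :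
    Summable fun x => wt a x * F x := by
  refine Summable.of_norm_bounded (((summable_wt a).add ha).mul_left C) fun x => ?_
  rw [Real.norm_eq_abs, abs_mul, abs_of_nonneg (wt_nonneg a x)]
  calc wt a x * |F x| ≤ wt a x * (C * (1 + dist x 1)) :=
        mul_le_mul_of_nonneg_left (hF x) (wt_nonneg a x)
    _ = _ := by ring

variable [IsIsometricSMul Γ Γ]

lemma hasSum_increment {a μ : PMF Γ} (ha : Summable fun x => wt a x * dist x 1)
    (hμ : Summable fun x => wt μ x * dist x 1) {F : Γ → ℝ} {C : ℝ} (hC : 0 ≤ C)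
    (hF : ∀ x, |F x| ≤ C * (1 + dist x 1)) :
    HasSum (fun p : Γ × Γ => wt a p.1 * wt μ p.2 * (F (p.1 * p.2) - F p.1))
      (∑' x, wt (mulConv a μ) x * F x - ∑' x, wt a x * F x) := by
  have h1 : Summable fun p : Γ × Γ => wt a p.1 * wt μ p.2 * F (p.1 * p.2) := by
    have hb := ((hasSum_mul_prod (hasSum_wt a) (hasSum_wt μ)).add
      ((hasSum_mul_prod ha.hasSum (hasSum_wt μ)).add
        (hasSum_mul_prod (hasSum_wt a) hμ.hasSum))).summable.mul_left C
    refine Summable.of_norm_bounded hb fun p => ?_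
    have h0 : 0 ≤ wt a p.1 * wt μ p.2 := mul_nonneg (wt_nonneg _ _) (wt_nonneg _ _)
    rw [Real.norm_eq_abs, abs_mul, abs_of_nonneg h0]
    calc wt a p.1 * wt μ p.2 * |F (p.1 * p.2)|
        ≤ wt a p.1 * wt μ p.2 * (C * (1 + (dist p.1 1 + dist p.2 1))) := by
          refine mul_le_mul_of_nonneg_left ((hF _).trans ?_) h0
          have := dist_mul_one_le p.1 p.2
          gcongr
      _ = _ := by ring
  have h2 := hasSum_mul_prod (summable_wt_mul_of_linear ha hF).hasSum (hasSum_wt μ)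
  rw [mul_one] at h2
  rw [(hasSum_mulConv a μ h1.hasSum).tsum_eq]
  exact (h1.hasSum.sub h2).congr_fun fun p => by ring

lemma hasSum_increment_occupation {μ : PMF Γ} (h : FiniteSecondMoment μ) (n : ℕ)
    {F : Γ → ℝ} {C : ℝ} (hC : 0 ≤ C) (hF : ∀ x, |F x| ≤ C * (1 + dist x 1)) :
    HasSum (fun p : Γ × Γ => occupation μ n p.1 * wt μ p.2 * (F (p.1 * p.2) - F p.1))
      ((∑' x, wt (delayed μ n) x * F x - F 1) / (n + 1)) := by
  have hk : ∀ k ∈ Finset.range n, HasSum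
      (fun p : Γ × Γ => wt (convPow μ k) p.1 * wt μ p.2 * (F (p.1 * p.2) - F p.1))
      (∑' x, wt (convPow μ (k + 1)) x * F x - ∑' x, wt (convPow μ k) x * F x) := fun k _ =>
    hasSum_increment (h.convPow k).summable_dist h.summable_dist hC hF
  have hq := hasSum_increment (hasSum_dist_delayed h n).summable h.summable_dist hC hF
  have hsum := ((hasSum_sum hk).add hq).div_const (n + 1 : ℝ)
  rw [Finset.sum_range_sub fun k => ∑' x, wt (convPow μ k) x * F x, mulConv_delayed] at hsum
  have h0 : ∑' x, wt (convPow μ 0) x * F x = F 1 := (hasSum_wt_pure_one F).tsum_eq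
  have hd : ∑' x, wt (delayed μ n) x * F x =
      (∑' x, wt (convPow μ n) x * F x + ∑' x, wt (delayed μ (n + 1)) x * F x) / 2 := by
    rw [← (summable_wt_mul_of_linear (h.convPow n).summable_dist hF).tsum_add
      (summable_wt_mul_of_linear (hasSum_dist_delayed h (n + 1)).summable hF), ← tsum_div_const]
    refine tsum_congr fun x => ?_
    rw [wt_delayed]
    ring
  have hvalue : (∑' x, wt (delayed μ n) x * F x - F 1) / (n + 1) =
      (∑' x, wt (convPow μ n) x * F x - ∑' x, wt (convPow μ 0) x * F x +
        (∑' x, wt (delayed μ (n + 1)) x * F x - ∑' x, wt (delayed μ n) x * F x)) / (n + 1) := by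
    rw [h0]
    congr 1
    linarith
  rw [hvalue]
  refine hsum.congr_fun fun p => ?_
  rw [occupation, ← Finset.sum_mul, ← Finset.sum_mul]
  ring

lemma hasSum_parts_occupation {μ : PMF Γ} (hsymm : IsSymmetric μ) (h : FiniteSecondMoment μ)
    (n : ℕ) {F : Γ → ℝ} {C : ℝ} (hC : 0 ≤ C) (hF : ∀ x, |F x| ≤ C * (1 + dist x 1)) :
    HasSum (fun p : Γ × Γ =>
      wt μ p.2 * ((occupation μ n p.1 - occupation μ n (p.1 * p.2)) *
        (F (p.1 * p.2) - F p.1) / 2))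
      ((∑' x, wt (delayed μ n) x * F x - F 1) / (n + 1)) :=
  hasSum_parts hsymm (u := occupation μ n) (F := F) (hasSum_increment_occupation h n hC hF)

end Parts

section DriftBound

variable {Γ : Type*}

/-- The information function `-log u` of a density, truncated at `-log κ`. -/
def truncInfo (u : Γ → ℝ) (κ : ℝ) (x : Γ) : ℝ := -Real.log (max (u x) κ)

/-- The total mass of a density truncated from above at `κ`. -/
def truncMass (u : Γ → ℝ) (κ : ℝ) : ℝ := ∑' x, min (u x) κ

lemma truncInfo_nonneg {u : Γ → ℝ} {κ : ℝ} {x : Γ} (hu : u x ≤ 1) (hκ : 0 < κ) (hκ1 : κ ≤ 1) :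
    0 ≤ truncInfo u κ x :=
  neg_nonneg.2 (Real.log_nonpos (le_max_of_le_right hκ.le) (max_le hu hκ1))

lemma truncInfo_le (u : Γ → ℝ) {κ : ℝ} (hκ : 0 < κ) (x : Γ) : truncInfo u κ x ≤ -Real.log κ :=
  neg_le_neg (Real.log_le_log hκ (le_max_right _ _))

lemma abs_truncInfo_le {u : Γ → ℝ} {κ : ℝ} {x : Γ} (hu : u x ≤ 1) (hκ : 0 < κ) (hκ1 : κ ≤ 1) :
    |truncInfo u κ x| ≤ -Real.log κ := by
  rw [abs_of_nonneg (truncInfo_nonneg hu hκ hκ1)]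
  exact truncInfo_le u hκ x

lemma summable_min {u : Γ → ℝ} (hu0 : ∀ x, 0 ≤ u x) (hu : Summable u) {κ : ℝ} (hκ : 0 < κ) :
    Summable fun x => min (u x) κ :=
  hu.of_nonneg_of_le (fun x => le_min (hu0 x) hκ.le) fun _ => min_le_left _ _

variable [Group Γ] [MetricSpace Γ]

lemma tsum_truncInfo_le (hproper : ProperDist Γ) (μ : PMF Γ) (n : ℕ) {κ R : ℝ} (hκ : 0 < κ)
    (hκ1 : κ ≤ 1) (hR : 0 ≤ R) :
    ∑' x, wt (delayed μ n) x * truncInfo (occupation μ n) κ x ≤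
      Real.log (ballCard Γ R) + 1 + (Real.log (n + 1) + -Real.log κ * tail (delayed μ n) R) := by
  set q := delayed μ n
  have hn : (0 : ℝ) < n + 1 := by positivity
  have hlogn : 0 ≤ Real.log (n + 1) := Real.log_nonneg (by simp)
  have hG : HasSum (fun x => wt q x *
        (Real.log (n + 1) + -Real.log κ * (if R < dist x 1 then (1 : ℝ) else 0)))
      (1 * Real.log (n + 1) + -Real.log κ * tail q R) :=
    (((hasSum_wt q).mul_right _).add ((summable_tail q R).hasSum.mul_left _)).congr_fun
      fun x => by ring
  have hF : Summable fun x => wt q x * truncInfo (occupation μ n) κ x :=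
    summable_wt_mul_of_abs_le q fun x => abs_truncInfo_le (occupation_le_one μ n x) hκ hκ1
  have h := tsum_wt_mul_le_log_ballCard_add hproper hR hF hG.summable (fun x hx hxR => ?_)
    fun x hxR => ?_
  · rwa [hG.tsum_eq, one_mul] at h
  · have hlog : Real.log (wt q x / (n + 1)) ≤ Real.log (max (occupation μ n x) κ) :=
      Real.log_le_log (div_pos hx hn)
        ((wt_delayed_le_occupation μ n x).trans (le_max_left _ _))
    rw [Real.log_div hx.ne' hn.ne'] at hlog
    rw [truncInfo, if_neg hxR.not_gt]
    linarith
  · rw [if_pos hxR, mul_one]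
    exact (truncInfo_le _ hκ x).trans (le_add_of_nonneg_left hlogn)

lemma tsum_truncInfo_exp_le (hproper : ProperDist Γ) (μ : PMF Γ) {n : ℕ} {K δ η R : ℝ}
    (hδ : 0 ≤ δ) (hδK : δ ≤ K) (hR : 0 ≤ R) (hlogR : Real.log (ballCard Γ R) ≤ (K - δ) * n)
    (hdelayed : tail (delayed μ n) R ≤ η) (hKη : K * η ≤ δ / 2)
    (hlogn : 1 + Real.log (n + 1) ≤ δ / 2 * (n + 1)) :
    (∑' x, wt (delayed μ n) x * truncInfo (occupation μ n) (Real.exp (-(K * n))) x) / (n + 1) ≤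
      K := by
  have hKn : 0 ≤ K * n := mul_nonneg (hδ.trans hδK) n.cast_nonneg
  rw [div_le_iff₀ (by positivity)]
  refine (tsum_truncInfo_le hproper μ n (Real.exp_pos _)
    (Real.exp_le_one_iff.2 (neg_nonpos.2 hKn)) hR).trans ?_
  rw [Real.log_exp, neg_neg]
  have htail : K * n * tail (delayed μ n) R ≤ δ / 2 * n :=
    calc K * n * tail (delayed μ n) R ≤ K * n * η := mul_le_mul_of_nonneg_left hdelayed hKn
      _ = K * η * n := by ring
      _ ≤ δ / 2 * n := mul_le_mul_of_nonneg_right hKη n.cast_nonneg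
  linarith

lemma truncMass_occupation_le (hproper : ProperDist Γ) (μ : PMF Γ) (n : ℕ) {κ R : ℝ}
    (hκ : 0 < κ) :
    truncMass (occupation μ n) κ ≤ κ * ballCard Γ R +
      (∑ k ∈ Finset.range n, tail (convPow μ k) R + tail (delayed μ n) R) / (n + 1) := by
  have hball := hasSum_ite_ball hproper (fun _ => κ) R
  rw [Finset.sum_const, nsmul_eq_mul, ← ballCard_eq_card, mul_comm] at hball
  have htail := hasSum_occupation_mul μ n (fun k => summable_tail (convPow μ k) R)
    (summable_tail _ R)
  refine hasSum_le (fun x => ?_)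
    (summable_min (occupation_nonneg μ n) (hasSum_occupation μ n).summable hκ).hasSum
    (hball.add htail)
  by_cases hx : dist x 1 ≤ R
  · simp [hx, hx.not_gt]
  · simp [hx, not_le.1 hx]

lemma truncMass_occupation_exp_le (hproper : ProperDist Γ) (μ : PMF Γ) {n : ℕ} {K δ η R : ℝ}
    (hR : 0 ≤ R) (hlogR : Real.log (ballCard Γ R) ≤ (K - δ) * n)
    (hconv : ∀ k ≤ n, tail (convPow μ k) R ≤ η) (hdelayed : tail (delayed μ n) R ≤ η) :
    truncMass (occupation μ n) (Real.exp (-(K * n))) ≤ Real.exp (-(δ * n)) + η := by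
  refine (truncMass_occupation_le hproper μ n (R := R) (Real.exp_pos _)).trans (add_le_add ?_ ?_)
  · rw [← Real.exp_log (zero_lt_one.trans_le (one_le_ballCard hproper hR)), ← Real.exp_add]
    exact Real.exp_le_exp.2 (by linarith)
  · have hsum := Finset.sum_le_card_nsmul (Finset.range n) (fun k => tail (convPow μ k) R) η
      fun k hk => hconv k (Finset.mem_range.1 hk).le
    rw [Finset.card_range, nsmul_eq_mul] at hsum
    rw [div_le_iff₀ (by positivity)]
    linarith

lemma hasSum_wt_mul_edgeCost {μ : PMF Γ} (hmom : FiniteSecondMoment μ) (hM : 0 < M₂ μ) (τ : ℝ) :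
    HasSum (fun γ => wt μ γ * edgeCost τ (dist γ 1 / M₂ μ)) (2 * Real.sinh τ ^ 2) := by
  have h := (((hasSum_wt μ).mul_left (artanhSlope τ - 2 * τ)).add
    (((hasSum_M₂_sq hmom).div_const (M₂ μ ^ 2)).mul_left (artanhSlope τ))).mul_left (Real.tanh τ)
  have hvalue : 2 * Real.sinh τ ^ 2 = Real.tanh τ *
      ((artanhSlope τ - 2 * τ) * 1 + artanhSlope τ * (M₂ μ ^ 2 / M₂ μ ^ 2)) := by
    have := (Real.cosh_pos τ).ne'
    rw [div_self (by positivity), Real.tanh_eq_sinh_div_cosh, artanhSlope]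
    field_simp
    ring
  rw [hvalue]
  refine h.congr_fun fun γ => ?_
  rw [edgeCost, div_pow]
  ring

variable [IsIsometricSMul Γ Γ]

lemma weighted_edge_production (μ : PMF Γ) {u : Γ → ℝ} (hu : ∀ x, 0 ≤ u x)
    {M τ κ : ℝ} (hM : 0 < M) (hτ : 0 < τ) (hκ : 0 < κ) (x γ : Γ) :
    2 * artanhSlope τ / M *
        (wt μ γ * ((u x - u (x * γ)) * (dist (x * γ) 1 - dist x 1) / 2) -
          wt μ γ * dist γ 1 * ((min (u x) κ + min (u (x * γ)) κ) / 2)) -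
      wt μ γ * edgeCost τ (dist γ 1 / M) *
        ((u x + min (u x) κ + (u (x * γ) + min (u (x * γ)) κ)) / 2) ≤
      wt μ γ * ((u x - u (x * γ)) * (truncInfo u κ (x * γ) - truncInfo u κ x) / 2) := by
  have hedge := edge_production_truncated (hu x) (hu (x * γ)) hκ hτ
    (div_nonneg dist_nonneg hM.le : 0 ≤ dist γ 1 / M)
  have hlength : (u x - u (x * γ)) * (dist (x * γ) 1 - dist x 1) ≤
      dist γ 1 * |u x - u (x * γ)| := by
    refine (le_abs_self _).trans ?_
    rw [abs_mul, mul_comm]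
    exact mul_le_mul_of_nonneg_right (abs_dist_mul_sub_le x γ) (abs_nonneg _)
  have hslope : 0 ≤ artanhSlope τ / M := by
    have := artanhSlope_pos hτ
    positivity
  have h := mul_le_mul_of_nonneg_left
    (add_le_add (mul_le_mul_of_nonneg_left hlength hslope) hedge) (wt_nonneg μ γ)
  rw [truncInfo, truncInfo]
  linear_combination h

lemma length_production_le_entropy_production {μ : PMF Γ} (hmom : FiniteSecondMoment μ)
    (hM : 0 < M₂ μ) {u : Γ → ℝ} (hu : ∀ x, 0 ≤ u x) (hu1 : HasSum u 1) {τ κ d e : ℝ}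
    (hτ : 0 < τ) (hκ : 0 < κ)
    (hd : HasSum (fun p : Γ × Γ =>
      wt μ p.2 * ((u p.1 - u (p.1 * p.2)) * (dist (p.1 * p.2) 1 - dist p.1 1) / 2)) d)
    (he : HasSum (fun p : Γ × Γ => wt μ p.2 * ((u p.1 - u (p.1 * p.2)) *
      (truncInfo u κ (p.1 * p.2) - truncInfo u κ p.1) / 2)) e) :
    2 * artanhSlope τ / M₂ μ * (d - meanLength μ * truncMass u κ)
      - 2 * Real.sinh τ ^ 2 * (1 + truncMass u κ) ≤ e := by
  have hσ := (summable_min hu hu1.summable hκ).hasSum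
  have hlength := hasSum_edge hmom.hasSum_dist hσ
  have hcost := hasSum_edge (hasSum_wt_mul_edgeCost hmom hM τ) (hu1.add hσ)
  have hlow := ((hd.sub hlength).mul_left (2 * artanhSlope τ / M₂ μ)).sub hcost
  refine hasSum_le (fun p => ?_) hlow he
  exact weighted_edge_production μ hu hM hτ hκ p.1 p.2

lemma drift_le_production {μ : PMF Γ} (hsymm : IsSymmetric μ) (hmom : FiniteSecondMoment μ)
    (hM : 0 < M₂ μ) {τ κ : ℝ} (hτ : 0 < τ) (hκ : 0 < κ) (hκ1 : κ ≤ 1) (n : ℕ) :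
    2 * artanhSlope τ / M₂ μ *
        (n * drift hmom / (n + 1) - meanLength μ * truncMass (occupation μ n) κ)
      - 2 * Real.sinh τ ^ 2 * (1 + truncMass (occupation μ n) κ) ≤
      (∑' x, wt (delayed μ n) x * truncInfo (occupation μ n) κ x) / (n + 1) := by
  set u := occupation μ n
  have hdist (x : Γ) : |dist x 1| ≤ 1 * (1 + dist x 1) := by
    rw [abs_of_nonneg dist_nonneg]; linarith
  have hd := hasSum_parts_occupation hsymm hmom n zero_le_one hdist
  have hlogκ : 0 ≤ -Real.log κ := neg_nonneg.2 (Real.log_nonpos hκ.le hκ1)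
  have he := hasSum_parts_occupation hsymm hmom n (F := truncInfo u κ) hlogκ fun x =>
    (abs_truncInfo_le (occupation_le_one μ n x) hκ hκ1).trans
      (le_mul_of_one_le_right hlogκ (le_add_of_nonneg_right dist_nonneg))
  have hslope : 0 ≤ 2 * artanhSlope τ / M₂ μ := by
    have := artanhSlope_pos hτ
    positivity
  calc _ ≤ 2 * artanhSlope τ / M₂ μ *
          ((∑' x, wt (delayed μ n) x * dist x 1 - dist (1 : Γ) 1) / (n + 1) -
            meanLength μ * truncMass u κ) - 2 * Real.sinh τ ^ 2 * (1 + truncMass u κ) := by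
        gcongr
        rw [dist_self, sub_zero]
        exact mul_drift_le_meanLength_delayed hmom n
    _ ≤ (∑' x, wt (delayed μ n) x * truncInfo u κ x - truncInfo u κ 1) / (n + 1) :=
        length_production_le_entropy_production hmom hM (occupation_nonneg μ n)
          (hasSum_occupation μ n) hτ hκ hd he
    _ ≤ _ := by
        gcongr
        exact sub_le_self _ (truncInfo_nonneg (occupation_le_one μ n 1) hκ hκ1)

lemma eventually_one_add_log_le {ε : ℝ} (hε : 0 < ε) :
    ∀ᶠ n : ℕ in atTop, 1 + Real.log (n + 1) ≤ ε * (n + 1) := by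
  have hlittle : (fun x : ℝ => 1 + Real.log x) =o[atTop] (id : ℝ → ℝ) :=
    (Asymptotics.isLittleO_const_id_atTop 1).add Real.isLittleO_log_id_atTop
  filter_upwards [(tendsto_atTop_add_const_right atTop (1 : ℝ)
    (tendsto_natCast_atTop_atTop (R := ℝ))).eventually (hlittle.def hε)] with n hn
  have := (le_abs_self _).trans hn
  rwa [id, Real.norm_of_nonneg (by positivity)] at this

lemma eventually_exp_neg_mul_le {δ ε : ℝ} (hδ : 0 < δ) (hε : 0 < ε) :
    ∀ᶠ n : ℕ in atTop, Real.exp (-(δ * n)) ≤ ε :=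
  (Real.tendsto_exp_neg_atTop_nhds_zero.comp
    (tendsto_natCast_atTop_atTop.const_mul_atTop hδ)).eventually_le_const hε

-- The walk stays in a ball of cardinality about `exp (n v ℓ)`, so `κ` slightly below
-- `exp (-n v ℓ)` truncates little mass.
lemma frequently_exists_truncation (hproper : ProperDist Γ) {v : ℝ}
    (hv : volumeGrowth Γ = (v : EReal)) {μ : PMF Γ} (hmom : FiniteSecondMoment μ) {ε : ℝ}
    (hε : 0 < ε) :
    ∃ᶠ n : ℕ in atTop, ∃ κ, 0 < κ ∧ κ ≤ 1 ∧ truncMass (occupation μ n) κ ≤ ε ∧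
      (∑' x, wt (delayed μ n) x * truncInfo (occupation μ n) κ x) / (n + 1) ≤
        v * drift hmom + ε := by
  have hv0 := nonneg_of_volumeGrowth_eq hproper hv
  have hℓ := drift_nonneg hmom
  obtain ⟨c, hvc, hc⟩ : ∃ c, v * c < v * drift hmom + ε / 4 ∧ drift hmom < c :=
    (((((continuous_const_mul v).tendsto (drift hmom)).eventually_lt_const
      (lt_add_of_pos_right _ (by positivity))).filter_mono nhdsWithin_le_nhds).and
        self_mem_nhdsWithin).exists (f := 𝓝[>] drift hmom)
  set K := v * drift hmom + ε
  have hK0 : 0 < K := by positivity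
  obtain ⟨η, hη, hηε, hKη⟩ : ∃ η > 0, η ≤ ε / 2 ∧ K * η ≤ ε / 4 :=
    ⟨min (ε / 2) (ε / 4 / K), by positivity, min_le_left _ _,
      (mul_le_mul_of_nonneg_left (min_le_right _ _) hK0.le).trans_eq (by field_simp)⟩
  refine ((frequently_exists_log_ballCard_le hproper hv (hℓ.trans_lt hc)
    (by positivity : 0 < ε / 4)).and_eventually ((eventually_tail_convPow_le hmom hc hη).and
      ((eventually_tail_delayed_le hmom hc hη).and
        ((eventually_one_add_log_le (by positivity : 0 < ε / 4)).and
          (eventually_exp_neg_mul_le (half_pos hε) (half_pos hε)))))).mono ?_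
  rintro n ⟨⟨R, hR, hlogR⟩, hconv, hdelayed, hlogn, hexp⟩
  have hR0 : 0 ≤ R := (mul_nonneg (hℓ.trans hc.le) n.cast_nonneg).trans hR
  have hq := (tail_antitone (delayed μ n) hR).trans hdelayed
  have hlogR' : Real.log (ballCard Γ R) ≤ (K - ε / 2) * n :=
    hlogR.trans (mul_le_mul_of_nonneg_right (by linarith) n.cast_nonneg)
  refine ⟨Real.exp (-(K * n)), Real.exp_pos _,
    Real.exp_le_one_iff.2 (neg_nonpos.2 (by positivity)), ?_,
    tsum_truncInfo_exp_le hproper μ (half_pos hε).le ?_ hR0 hlogR' hq (by linarith)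
      (by linarith)⟩
  · have := truncMass_occupation_exp_le hproper μ hR0 hlogR'
      (fun k hk => (tail_antitone _ hR).trans (hconv k hk)) hq
    linarith
  · have : 0 ≤ v * drift hmom := by positivity
    linarith

lemma artanhSlope_mul_drift_le (hproper : ProperDist Γ) {v : ℝ}
    (hv : volumeGrowth Γ = (v : EReal)) {μ : PMF Γ} (hsymm : IsSymmetric μ)
    (hmom : FiniteSecondMoment μ) (hM : 0 < M₂ μ) {τ : ℝ} (hτ : 0 < τ) :
    2 * artanhSlope τ / M₂ μ * drift hmom - 2 * Real.sinh τ ^ 2 ≤ v * drift hmom := by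
  have hslope : 0 ≤ 2 * artanhSlope τ / M₂ μ := by
    have := artanhSlope_pos hτ
    positivity
  have hm := meanLength_nonneg μ
  have htime : Tendsto (fun n : ℕ => (n : ℝ) * drift hmom / (n + 1)) atTop (𝓝 (drift hmom)) := by
    simpa [div_mul_eq_mul_div] using
      (tendsto_natCast_div_add_atTop (1 : ℝ)).mul_const (drift hmom)
  have key : ∀ ε > 0, 2 * artanhSlope τ / M₂ μ * (drift hmom - ε - meanLength μ * ε)
      - 2 * Real.sinh τ ^ 2 * (1 + ε) ≤ v * drift hmom + ε := by
    intro ε hε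
    obtain ⟨n, ⟨κ, hκ, hκ1, hmass, hinfo⟩, hn⟩ :=
      ((frequently_exists_truncation hproper hv hmom hε).and_eventually
        (htime.eventually_const_le (sub_lt_self _ hε))).exists
    refine le_trans ?_ ((drift_le_production hsymm hmom hM hτ hκ hκ1 n).trans hinfo)
    gcongr
  have hleft : Tendsto (fun ε => 2 * artanhSlope τ / M₂ μ *
      (drift hmom - ε - meanLength μ * ε) - 2 * Real.sinh τ ^ 2 * (1 + ε)) (𝓝[>] 0)
      (𝓝 (2 * artanhSlope τ / M₂ μ * drift hmom - 2 * Real.sinh τ ^ 2)) :=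
    (Continuous.tendsto' (by fun_prop) 0 _ (by ring)).mono_left nhdsWithin_le_nhds
  have hright : Tendsto (fun ε => v * drift hmom + ε) (𝓝[>] 0) (𝓝 (v * drift hmom)) :=
    (Continuous.tendsto' (by fun_prop) 0 _ (by ring)).mono_left nhdsWithin_le_nhds
  exact le_of_tendsto_of_tendsto hleft hright (eventually_nhdsWithin_of_forall key)

lemma drift_div_le_tanh (hproper : ProperDist Γ) {v : ℝ} (hv : volumeGrowth Γ = (v : EReal))
    {μ : PMF Γ} (hsymm : IsSymmetric μ) (hmom : FiniteSecondMoment μ) :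
    drift hmom / M₂ μ ≤ Real.tanh (M₂ μ * v / 2) := by
  have hv0 := nonneg_of_volumeGrowth_eq hproper hv
  rcases (M₂_nonneg μ).eq_or_lt with hM | hM
  · simp [← hM]
  have key : ∀ τ > M₂ μ * v / 2, drift hmom / M₂ μ ≤ Real.tanh τ := by
    intro τ hτ
    have hτ0 : 0 < τ := lt_of_le_of_lt (by positivity) hτ
    have h := artanhSlope_mul_drift_le hproper hv hsymm hmom hM hτ0
    have hx : 0 ≤ drift hmom / M₂ μ := div_nonneg (drift_nonneg hmom) hM.le
    have hvτ : v * drift hmom ≤ 2 * τ * (drift hmom / M₂ μ) :=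
      calc v * drift hmom = M₂ μ * v * (drift hmom / M₂ μ) := by field_simp
        _ ≤ 2 * τ * (drift hmom / M₂ μ) := mul_le_mul_of_nonneg_right (by linarith) hx
    rw [artanhSlope, div_mul_eq_mul_div, mul_div_assoc] at h
    rw [Real.tanh_eq_sinh_div_cosh, le_div_iff₀ (Real.cosh_pos τ)]
    refine le_of_mul_le_mul_left ?_ (Real.sinh_pos_iff.2 hτ0)
    linarith
  exact ge_of_tendsto (continuous_tanh.continuousAt.tendsto.mono_left nhdsWithin_le_nhds)
    (eventually_nhdsWithin_of_forall (s := Set.Ioi (M₂ μ * v / 2)) key)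

lemma drift_le_mul_tanh (hproper : ProperDist Γ) {v : ℝ} (hv : volumeGrowth Γ = (v : EReal))
    {μ : PMF Γ} (hsymm : IsSymmetric μ) (hmom : FiniteSecondMoment μ) :
    drift hmom ≤ M₂ μ * Real.tanh (M₂ μ * v / 2) := by
  rcases (M₂_nonneg μ).eq_or_lt with hM | hM
  · have h0 := drift_le_meanLength hmom
    rw [meanLength_eq_zero_of_M₂_eq_zero hmom hM.symm] at h0
    simpa [← hM] using h0
  · rw [← div_le_iff₀' hM]
    exact drift_div_le_tanh hproper hv hsymm hmom

end DriftBound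

section Spectral

variable {Γ : Type*} [Group Γ]

lemma wt_mulConv_inv {a b : PMF Γ} (ha : IsSymmetric a) (hb : IsSymmetric b) (z : Γ) :
    wt (mulConv a b) z⁻¹ = wt (mulConv b a) z := by
  rw [wt_mulConv, wt_mulConv]
  refine Eq.trans (tsum_congr fun x => ?_) ((Equiv.mulLeft z).tsum_eq _)
  simp only [Equiv.coe_mulLeft]
  rw [mul_comm, ← hb.wt_inv (z * x), mul_inv_rev, inv_mul_cancel_right, ha.wt_inv]

lemma IsSymmetric.convPow {μ : PMF Γ} (h : IsSymmetric μ) (n : ℕ) :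
    IsSymmetric (convPow μ n) := by
  induction n with
  | zero =>
    intro g
    classical
    change PMF.pure (1 : Γ) g⁻¹ = PMF.pure (1 : Γ) g
    simp [PMF.pure_apply]
  | succ n ih =>
    intro g
    have hcomm : RandomWalk.mulConv μ (RandomWalk.convPow μ n) = RandomWalk.convPow μ (n + 1) := by
      rw [add_comm, convPow_add, convPow_one]
    have hinv := wt_mulConv_inv ih h g
    rw [← convPow_succ, hcomm] at hinv
    exact (ENNReal.toReal_eq_toReal_iff' (PMF.apply_ne_top _ _) (PMF.apply_ne_top _ _)).1 hinv

lemma hasSum_wt_mul_wt {a : PMF Γ} (ha : IsSymmetric a) (x y : Γ) :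
    HasSum (fun z => wt a (x⁻¹ * z) * wt a (y⁻¹ * z)) (wt (mulConv a a) (x⁻¹ * y)) := by
  have h := (summable_wt_mulConv a a (x⁻¹ * y)).hasSum
  rw [← wt_mulConv] at h
  refine ((Equiv.mulLeft x⁻¹).hasSum_iff.2 h).congr_fun fun z => ?_
  simp only [Function.comp, Equiv.coe_mulLeft]
  rw [← ha.wt_inv (y⁻¹ * z)]
  simp

lemma wt_mulConv_self_le {a : PMF Γ} (ha : IsSymmetric a) (g : Γ) :
    wt (mulConv a a) g ≤ wt (mulConv a a) 1 := by
  have hcross := hasSum_wt_mul_wt ha 1 g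
  have hdiag := ((hasSum_wt_mul_wt ha 1 1).add (hasSum_wt_mul_wt ha g g)).div_const 2
  rw [inv_mul_cancel, inv_mul_cancel, add_self_div_two] at hdiag
  rw [inv_one, one_mul] at hcross
  refine hasSum_le (fun z => ?_) hcross hdiag
  simp only [inv_one, one_mul]
  linarith [two_mul_le_add_sq (wt a z) (wt a (g⁻¹ * z))]

/-- The quadratic form `⟨f, P f⟩` of the convolution operator with law `a`, for a function
supported in the finite set `s`. -/
def quadForm (s : Finset Γ) (f : Γ → ℝ) (a : PMF Γ) : ℝ :=
  ∑ x ∈ s, ∑ y ∈ s, f x * f y * wt a (x⁻¹ * y)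

lemma quadForm_sq_le (s : Finset Γ) (f : Γ → ℝ) {a : PMF Γ} (ha : IsSymmetric a) :
    quadForm s f a ^ 2 ≤ (∑ x ∈ s, f x ^ 2) * quadForm s f (mulConv a a) := by
  set φ : Γ → ℝ := fun y => ∑ x ∈ s, f x * wt a (x⁻¹ * y) with hφ
  have hinner : quadForm s f a = ∑ y ∈ s, f y * φ y := by
    rw [quadForm, Finset.sum_comm]
    refine Finset.sum_congr rfl fun y _ => ?_
    rw [hφ, Finset.mul_sum]
    exact Finset.sum_congr rfl fun x _ => by ring
  have hnorm : HasSum (fun y => φ y ^ 2) (quadForm s f (mulConv a a)) := by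
    refine (hasSum_sum fun x (_ : x ∈ s) => hasSum_sum fun x' (_ : x' ∈ s) =>
      (hasSum_wt_mul_wt ha x x').mul_left (f x * f x')).congr_fun fun y => ?_
    rw [hφ, sq, Finset.sum_mul_sum]
    exact Finset.sum_congr rfl fun x _ => Finset.sum_congr rfl fun x' _ => by ring
  rw [hinner]
  refine (Finset.sum_mul_sq_le_sq_mul_sq s f φ).trans ?_
  exact mul_le_mul_of_nonneg_left (sum_le_hasSum s (fun y _ => sq_nonneg _) hnorm)
    (Finset.sum_nonneg fun x _ => sq_nonneg _)

lemma quadForm_mulConv_self_le {s : Finset Γ} {f : Γ → ℝ} (hf : ∀ x, 0 ≤ f x) {a : PMF Γ}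
    (ha : IsSymmetric a) :
    quadForm s f (mulConv a a) ≤ (∑ x ∈ s, f x) ^ 2 * wt (mulConv a a) 1 := by
  rw [quadForm, sq, Finset.sum_mul_sum, Finset.sum_mul]
  refine Finset.sum_le_sum fun x _ => ?_
  rw [Finset.sum_mul]
  exact Finset.sum_le_sum fun y _ =>
    mul_le_mul_of_nonneg_left (wt_mulConv_self_le ha _) (mul_nonneg (hf x) (hf y))

lemma quadForm_nonneg {s : Finset Γ} {f : Γ → ℝ} (hf : ∀ x, 0 ≤ f x) (a : PMF Γ) :
    0 ≤ quadForm s f a :=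
  Finset.sum_nonneg fun x _ => Finset.sum_nonneg fun y _ =>
    mul_nonneg (mul_nonneg (hf x) (hf y)) (wt_nonneg a _)

lemma quadForm_pow_le {s : Finset Γ} {f : Γ → ℝ} (hf : ∀ x, 0 ≤ f x)
    (hF : 0 < ∑ x ∈ s, f x ^ 2) {μ : PMF Γ} (hsymm : IsSymmetric μ) (k : ℕ) :
    (∑ x ∈ s, f x ^ 2) * (quadForm s f μ / ∑ x ∈ s, f x ^ 2) ^ 2 ^ k ≤
      quadForm s f (convPow μ (2 ^ k)) := by
  induction k with
  | zero => rw [pow_zero, pow_one, convPow_one, mul_div_cancel₀ _ hF.ne']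
  | succ k ih =>
    have hA : 0 ≤ quadForm s f μ / ∑ x ∈ s, f x ^ 2 := div_nonneg (quadForm_nonneg hf μ) hF.le
    have hsq := (pow_le_pow_left₀ (by positivity) ih 2).trans
      (quadForm_sq_le s f (hsymm.convPow (2 ^ k)))
    rw [← convPow_add, ← two_mul, ← pow_succ', mul_pow, sq (∑ x ∈ s, f x ^ 2), mul_assoc,
      ← pow_mul, ← pow_succ] at hsq
    exact le_of_mul_le_mul_left hsq hF

lemma le_spectralRadius_of_frequently {μ : PMF Γ} {c A : ℝ} (hc : 0 < c) (hA : 0 ≤ A)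
    (h : ∃ᶠ n : ℕ in atTop, c * A ^ n ≤ wt (convPow μ n) 1) : A ≤ spectralRadius μ := by
  have hbdd : IsBoundedUnder (· ≤ ·) atTop
      (fun n : ℕ => (convPow μ n 1).toReal ^ (1 / (n : ℝ))) :=
    isBoundedUnder_of ⟨1, fun n =>
      Real.rpow_le_one (wt_nonneg _ _) (wt_le_one _ _) (by positivity)⟩
  have hroot : Tendsto (fun n : ℕ => c ^ (1 / (n : ℝ)) * A) atTop (𝓝 A) := by
    simpa using (tendsto_const_nhds.rpow tendsto_one_div_atTop_nhds_zero_nat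
      (Or.inl hc.ne')).mul_const A
  refine le_of_forall_lt_imp_le_of_dense fun B hB => le_limsup_of_frequently_le ?_ hbdd
  refine (h.and_eventually ((hroot.eventually_const_le hB).and (eventually_ne_atTop 0))).mono ?_
  rintro n ⟨hn, hBn, hn0⟩
  calc B ≤ c ^ (1 / (n : ℝ)) * A := hBn
    _ = (c * A ^ n) ^ (1 / (n : ℝ)) := by
      rw [Real.mul_rpow hc.le (by positivity), one_div, Real.pow_rpow_inv_natCast hA hn0]
    _ ≤ _ := Real.rpow_le_rpow (by positivity) hn (by positivity)

lemma rayleigh_le_spectralRadius {s : Finset Γ} {f : Γ → ℝ} (hf : ∀ x, 0 ≤ f x)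
    (hF : 0 < ∑ x ∈ s, f x ^ 2) {μ : PMF Γ} (hsymm : IsSymmetric μ) :
    quadForm s f μ / ∑ x ∈ s, f x ^ 2 ≤ spectralRadius μ := by
  have hS : 0 < ∑ x ∈ s, f x := by
    refine (Finset.sum_nonneg fun x _ => hf x).lt_of_ne fun h => hF.ne' ?_
    have h0 := (Finset.sum_eq_zero_iff_of_nonneg fun x _ => hf x).1 h.symm
    exact Finset.sum_eq_zero fun x hx => by rw [h0 x hx, sq, mul_zero]
  have hpow : Tendsto (fun k : ℕ => 2 ^ (k + 1)) atTop atTop :=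
    (tendsto_pow_atTop_atTop_of_one_lt one_lt_two).comp (tendsto_add_atTop_nat 1)
  refine le_spectralRadius_of_frequently
    (c := (∑ x ∈ s, f x ^ 2) / (∑ x ∈ s, f x) ^ 2) (by positivity)
    (div_nonneg (quadForm_nonneg hf μ) hF.le)
    (hpow.frequently (Frequently.of_forall fun k => ?_))
  rw [div_mul_eq_mul_div, div_le_iff₀' (by positivity)]
  refine (quadForm_pow_le hf hF hsymm (k + 1)).trans ?_
  rw [pow_succ' 2 k, two_mul, convPow_add]
  exact quadForm_mulConv_self_le hf (hsymm.convPow _)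

lemma hasSum_quadForm {s : Finset Γ} {f : Γ → ℝ} (hfs : ∀ x ∉ s, f x = 0) (μ : PMF Γ) :
    HasSum (fun p : Γ × Γ => wt μ p.2 * (f p.1 * f (p.1 * p.2))) (quadForm s f μ) := by
  have h : HasSum (fun p : Γ × Γ => f p.1 * f p.2 * wt μ (p.1⁻¹ * p.2)) (quadForm s f μ) := by
    rw [quadForm, ← Finset.sum_product' s s fun x y => f x * f y * wt μ (x⁻¹ * y)]
    refine hasSum_sum_of_ne_finset_zero fun p hp => ?_
    rw [Finset.mem_product, not_and_or] at hp
    rcases hp with hp | hp <;> simp [hfs _ hp]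
  refine (((factorEquiv Γ).symm.trans (Equiv.prodComm Γ Γ)).hasSum_iff.2 h).congr_fun fun p => ?_
  change wt μ p.2 * (f p.1 * f (p.1 * p.2)) =
    f p.1 * f (p.1 * p.2) * wt μ (p.1⁻¹ * (p.1 * p.2))
  rw [inv_mul_cancel_left, mul_comm]

end Spectral

section TestFunction

/-- The test function `x ↦ e^{t (R - |x|)}` on the ball of radius `R`, as a function of
`r = |x|`. -/
def cutoffExp (t R r : ℝ) : ℝ := if r ≤ R then Real.exp (t * (R - r)) else 0

/-- The square of `cutoffExp` in the shell of width `k` below the radius `R`. -/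
def boundaryMass (t R k r : ℝ) : ℝ := if R - k < r then cutoffExp t R r ^ 2 else 0

lemma cutoffExp_of_lt {t R r : ℝ} (h : R < r) : cutoffExp t R r = 0 := if_neg h.not_ge

lemma cutoffExp_nonneg (t R r : ℝ) : 0 ≤ cutoffExp t R r := by
  rw [cutoffExp]
  split_ifs
  exacts [(Real.exp_pos _).le, le_rfl]

lemma boundaryMass_of_lt {t R k r : ℝ} (h : R < r) : boundaryMass t R k r = 0 := by
  rw [boundaryMass, cutoffExp_of_lt h, zero_pow two_ne_zero, ite_self]

lemma boundaryMass_nonneg (t R k r : ℝ) : 0 ≤ boundaryMass t R k r := by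
  rw [boundaryMass]
  split_ifs
  exacts [sq_nonneg _, le_rfl]

lemma boundaryMass_le {t : ℝ} (ht : 0 ≤ t) (R k r : ℝ) :
    boundaryMass t R k r ≤ Real.exp (2 * t * k) := by
  rw [boundaryMass, cutoffExp]
  split_ifs with hk hR
  · rw [← Real.exp_nat_mul]
    refine Real.exp_le_exp.2 ?_
    have : t * (R - r) ≤ t * k := mul_le_mul_of_nonneg_left (by linarith) ht
    push_cast
    linarith
  · simpa using (Real.exp_pos _).le
  · exact (Real.exp_pos _).le

lemma sq_exp_add_sq_exp_le {α β c : ℝ} (h : |α - β| ≤ c) :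
    (Real.exp α ^ 2 + Real.exp β ^ 2) / 2 ≤ Real.exp α * Real.exp β * Real.cosh c := by
  calc (Real.exp α ^ 2 + Real.exp β ^ 2) / 2
      = Real.exp α * Real.exp β * Real.cosh (α - β) := by
        rw [Real.cosh_eq, neg_sub, Real.exp_sub, Real.exp_sub]
        field_simp
    _ ≤ _ := by
        gcongr
        exact Real.cosh_le_cosh.2 (h.trans (le_abs_self c))

lemma cutoffExp_edge_of_le {t R r r' c S : ℝ} (ht : 0 ≤ t) (hr : |r - r'| ≤ c) (hrR : r ≤ R)
    (hrR' : r' ≤ R) (hS : S ≤ 1 / Real.cosh (t * c)) :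
    (cutoffExp t R r ^ 2 + cutoffExp t R r' ^ 2) / 2 * S ≤ cutoffExp t R r * cutoffExp t R r' := by
  have hexp : (cutoffExp t R r ^ 2 + cutoffExp t R r' ^ 2) / 2 ≤
      cutoffExp t R r * cutoffExp t R r' * Real.cosh (t * c) := by
    rw [cutoffExp, cutoffExp, if_pos hrR, if_pos hrR']
    refine sq_exp_add_sq_exp_le ?_
    rw [← mul_sub, abs_mul, abs_of_nonneg ht, sub_sub_sub_cancel_left, abs_sub_comm]
    exact mul_le_mul_of_nonneg_left hr ht
  calc (cutoffExp t R r ^ 2 + cutoffExp t R r' ^ 2) / 2 * S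
      ≤ (cutoffExp t R r ^ 2 + cutoffExp t R r' ^ 2) / 2 * (1 / Real.cosh (t * c)) := by gcongr
    _ ≤ cutoffExp t R r * cutoffExp t R r' := by
        rwa [mul_one_div, div_le_iff₀ (Real.cosh_pos _)]

-- A long edge has `S ≤ 0`, and a short edge that leaves the ball starts in the shell.
lemma cutoffExp_sq_mul_le_boundaryMass {t R k r r' c S : ℝ} (hk : 0 < k) (hr : |r - r'| ≤ c)
    (hrR' : R < r') (hS : S ≤ 1 / Real.cosh (t * c) - c ^ 2 / k ^ 2) :
    cutoffExp t R r ^ 2 * S ≤ boundaryMass t R k r := by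
  have hcosh : 1 / Real.cosh (t * c) ≤ 1 :=
    (div_le_one (Real.cosh_pos _)).2 (Real.one_le_cosh _)
  rcases lt_or_ge k c with hkc | hck
  · have hlong : 1 ≤ c ^ 2 / k ^ 2 := by rw [one_le_div (by positivity)]; gcongr
    exact (mul_nonpos_of_nonneg_of_nonpos (sq_nonneg _) (by linarith)).trans
      (boundaryMass_nonneg t R k r)
  · have hshell : boundaryMass t R k r = cutoffExp t R r ^ 2 :=
      if_pos (by linarith [(abs_le.1 hr).1])
    have hc2 : 0 ≤ c ^ 2 / k ^ 2 := by positivity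
    rw [hshell]
    exact mul_le_of_le_one_right (sq_nonneg _) (by linarith)

lemma cutoffExp_edge {t R k r r' c S : ℝ} (ht : 0 ≤ t) (hk : 0 < k) (hr : |r - r'| ≤ c)
    (hS : S ≤ 1 / Real.cosh (t * c) - c ^ 2 / k ^ 2) :
    (cutoffExp t R r ^ 2 + cutoffExp t R r' ^ 2) / 2 * S
      - (boundaryMass t R k r + boundaryMass t R k r') / 2 ≤
      cutoffExp t R r * cutoffExp t R r' := by
  wlog hle : r ≤ r' generalizing r r'
  · have := this (r := r') (r' := r) (by rwa [abs_sub_comm]) (le_of_not_ge hle)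
    linarith
  have hc2 : 0 ≤ c ^ 2 / k ^ 2 := by positivity
  rcases le_or_gt r' R with hr' | hr'
  · have hcosh : S ≤ 1 / Real.cosh (t * c) := by linarith
    have := cutoffExp_edge_of_le ht hr (hle.trans hr') hr' hcosh
    linarith [boundaryMass_nonneg t R k r, boundaryMass_nonneg t R k r']
  · have := cutoffExp_sq_mul_le_boundaryMass hk hr hr' hS
    rw [cutoffExp_of_lt hr', mul_zero, zero_pow two_ne_zero, add_zero]
    linarith [boundaryMass_nonneg t R k r']

variable {Γ : Type*} [Group Γ] [MetricSpace Γ]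

lemma hasSum_of_eq_zero_of_lt (hproper : ProperDist Γ) {F : Γ → ℝ} {R : ℝ}
    (hF : ∀ x, R < dist x 1 → F x = 0) : HasSum F (∑ x ∈ (hproper R).toFinset, F x) :=
  hasSum_sum_of_ne_finset_zero fun x hx =>
    hF x (not_le.1 (mt (mem_toFinset_ball hproper).2 hx))

lemma exp_le_sum_cutoffExp_sq (hproper : ProperDist Γ) (t : ℝ) {R : ℝ} (hR : 0 ≤ R) :
    Real.exp (2 * t * R) ≤ ∑ x ∈ (hproper R).toFinset, cutoffExp t R (dist x 1) ^ 2 := by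
  have h1 : (1 : Γ) ∈ (hproper R).toFinset := (mem_toFinset_ball hproper).2 (by rwa [dist_self])
  calc Real.exp (2 * t * R) = cutoffExp t R (dist (1 : Γ) 1) ^ 2 := by
        rw [dist_self, cutoffExp, if_pos hR, ← Real.exp_nat_mul]
        push_cast
        ring_nf
    _ ≤ _ := Finset.single_le_sum (f := fun x => cutoffExp t R (dist x 1) ^ 2)
        (fun x _ => sq_nonneg _) h1

lemma sum_boundaryMass_le (hproper : ProperDist Γ) {t : ℝ} (ht : 0 ≤ t) (R k : ℝ) :
    ∑ x ∈ (hproper R).toFinset, boundaryMass t R k (dist x 1) ≤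
      Real.exp (2 * t * k) * ballCard Γ R := by
  rw [ballCard_eq_card hproper, mul_comm, ← nsmul_eq_mul]
  exact Finset.sum_le_card_nsmul _ _ _ fun x _ => boundaryMass_le ht R k _

-- `S` is the tangent at `m` of the convex function `r² ↦ 1 / cosh (t r)`, minus `r² / k²`.
lemma exists_edge_weight {μ : PMF Γ} (hmom : FiniteSecondMoment μ) {t m : ℝ} (k : ℝ)
    (ht : 0 < t) (hm : M₂ μ < m) :
    ∃ (S : ℝ → ℝ) (σ : ℝ), (∀ r, 0 ≤ r → S r ≤ 1 / Real.cosh (t * r) - r ^ 2 / k ^ 2) ∧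
      HasSum (fun γ => wt μ γ * S (dist γ 1)) σ ∧
      1 / Real.cosh (t * m) - M₂ μ ^ 2 / k ^ 2 ≤ σ := by
  have htm : 0 < t * m := mul_pos ht ((M₂_nonneg μ).trans_lt hm)
  set q := Real.tanh (t * m) / (2 * (t * m) * Real.cosh (t * m)) * t ^ 2 with hq
  have hq0 : 0 ≤ q := by
    have := tanh_pos_of_pos htm
    have := Real.cosh_pos (t * m)
    positivity
  refine ⟨fun r => 1 / Real.cosh (t * m) - q * (r ^ 2 - m ^ 2) - r ^ 2 / k ^ 2,
    1 / Real.cosh (t * m) - q * (M₂ μ ^ 2 - m ^ 2) - M₂ μ ^ 2 / k ^ 2, fun r hr => ?_, ?_, ?_⟩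
  · have := one_div_cosh_tangent (mul_nonneg ht.le hr) htm
    rw [hq]
    linarith
  · have h := ((hasSum_wt μ).mul_right (1 / Real.cosh (t * m) + q * m ^ 2)).sub
      ((hasSum_M₂_sq hmom).mul_right (q + 1 / k ^ 2))
    have hvalue : 1 / Real.cosh (t * m) - q * (M₂ μ ^ 2 - m ^ 2) - M₂ μ ^ 2 / k ^ 2 =
        1 * (1 / Real.cosh (t * m) + q * m ^ 2) - M₂ μ ^ 2 * (q + 1 / k ^ 2) := by ring
    rw [hvalue]
    exact h.congr_fun fun γ => by ring
  · have := mul_nonneg hq0 (sub_nonneg.2 (pow_le_pow_left₀ (M₂_nonneg μ) hm.le 2))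
    linarith

variable [IsIsometricSMul Γ Γ]

lemma quadForm_cutoffExp_ge (hproper : ProperDist Γ) {μ : PMF Γ} {t R k σ : ℝ} {S : ℝ → ℝ}
    (ht : 0 ≤ t) (hk : 0 < k)
    (hS : ∀ r, 0 ≤ r → S r ≤ 1 / Real.cosh (t * r) - r ^ 2 / k ^ 2)
    (hσ : HasSum (fun γ => wt μ γ * S (dist γ 1)) σ) :
    σ * ∑ x ∈ (hproper R).toFinset, cutoffExp t R (dist x 1) ^ 2
        - Real.exp (2 * t * k) * ballCard Γ R ≤
      quadForm (hproper R).toFinset (fun x => cutoffExp t R (dist x 1)) μ := by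
  have hmass := hasSum_of_eq_zero_of_lt hproper (F := fun x => cutoffExp t R (dist x 1) ^ 2)
    fun x hx => by rw [cutoffExp_of_lt hx, zero_pow two_ne_zero]
  have hbdry := hasSum_of_eq_zero_of_lt hproper (F := fun x => boundaryMass t R k (dist x 1))
    fun x hx => boundaryMass_of_lt hx
  have hform := hasSum_quadForm (s := (hproper R).toFinset)
    (f := fun x => cutoffExp t R (dist x 1))
    (fun x hx => cutoffExp_of_lt (not_le.1 (mt (mem_toFinset_ball hproper).2 hx))) μ
  have hle := hasSum_le (fun p => ?_)
    ((hasSum_edge hσ hmass).sub (hasSum_edge (hasSum_wt μ) hbdry)) hform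
  · linarith [sum_boundaryMass_le hproper ht R k]
  · have hedge := cutoffExp_edge (R := R) ht hk
      ((abs_sub_comm _ _).trans_le (abs_dist_mul_sub_le p.1 p.2)) (hS _ dist_nonneg)
    have := mul_le_mul_of_nonneg_left hedge (wt_nonneg μ p.2)
    linarith

lemma spectralRadius_ge_of_ball (hproper : ProperDist Γ) {μ : PMF Γ} (hsymm : IsSymmetric μ)
    (hmom : FiniteSecondMoment μ) {t k m R : ℝ} (ht : 0 < t) (hk : 0 < k) (hm : M₂ μ < m)
    (hR : 0 ≤ R) :
    1 / Real.cosh (t * m) - M₂ μ ^ 2 / k ^ 2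
      - Real.exp (2 * t * k) * (ballCard Γ R / Real.exp (2 * t * R)) ≤ spectralRadius μ := by
  obtain ⟨S, σ, hS, hσ, hlow⟩ := exists_edge_weight hmom k ht hm
  have hform := quadForm_cutoffExp_ge hproper (R := R) ht.le hk hS hσ
  have hmass := exp_le_sum_cutoffExp_sq hproper t hR
  set F := ∑ x ∈ (hproper R).toFinset, cutoffExp t R (dist x 1) ^ 2
  have hF : 0 < F := (Real.exp_pos _).trans_le hmass
  have hB : 0 ≤ ballCard Γ R := zero_le_one.trans (one_le_ballCard hproper hR)
  calc _ ≤ σ - Real.exp (2 * t * k) * (ballCard Γ R / F) := by gcongr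
    _ = (σ * F - Real.exp (2 * t * k) * ballCard Γ R) / F := by field_simp
    _ ≤ quadForm (hproper R).toFinset (fun x => cutoffExp t R (dist x 1)) μ / F := by gcongr
    _ ≤ spectralRadius μ :=
        rayleigh_le_spectralRadius (fun x => cutoffExp_nonneg t R _) hF hsymm

lemma one_div_cosh_le_spectralRadius_of_lt (hproper : ProperDist Γ) {v : ℝ}
    (hv : volumeGrowth Γ = (v : EReal)) {μ : PMF Γ} (hsymm : IsSymmetric μ)
    (hmom : FiniteSecondMoment μ) {t m : ℝ} (ht : v / 2 < t) (hm : M₂ μ < m) :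
    1 / Real.cosh (t * m) ≤ spectralRadius μ := by
  have hv0 := nonneg_of_volumeGrowth_eq hproper hv
  have ht0 : 0 < t := lt_of_le_of_lt (by positivity) ht
  refine le_of_forall_pos_le_add fun ε hε => ?_
  have hklim : Tendsto (fun k : ℝ => M₂ μ ^ 2 / k ^ 2) atTop (𝓝 0) :=
    tendsto_const_nhds.div_atTop (tendsto_pow_atTop two_ne_zero)
  obtain ⟨k, hk, hk0⟩ :=
    ((hklim.eventually_le_const (half_pos hε)).and (eventually_gt_atTop 0)).exists
  have hδ : 0 < t - v / 2 := sub_pos.2 ht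
  have hv2 : v < v / 2 + t := by linarith
  obtain ⟨n, hn, hexp⟩ := ((frequently_log_ballCard_le hv hv2).and_eventually
    (eventually_exp_neg_mul_le hδ (by positivity : 0 < ε / 2 / Real.exp (2 * t * k)))).exists
  have h := spectralRadius_ge_of_ball hproper hsymm hmom ht0 hk0 hm n.cast_nonneg
  have hball : ballCard Γ n / Real.exp (2 * t * n) ≤ Real.exp (-((t - v / 2) * n)) := by
    rw [← Real.exp_log (zero_lt_one.trans_le (one_le_ballCard hproper n.cast_nonneg)),
      ← Real.exp_sub]
    exact Real.exp_le_exp.2 (by linarith)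
  have := (le_div_iff₀' (Real.exp_pos _)).1 (hball.trans hexp)
  linarith

lemma one_div_cosh_le_spectralRadius (hproper : ProperDist Γ) {v : ℝ}
    (hv : volumeGrowth Γ = (v : EReal)) {μ : PMF Γ} (hsymm : IsSymmetric μ)
    (hmom : FiniteSecondMoment μ) :
    1 / Real.cosh (M₂ μ * v / 2) ≤ spectralRadius μ := by
  have hcont : Continuous fun ε : ℝ => 1 / Real.cosh ((v / 2 + ε) * (M₂ μ + ε)) :=
    continuous_const.div (Real.continuous_cosh.comp (by fun_prop)) fun ε => (Real.cosh_pos _).ne'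
  have hlim : Tendsto (fun ε : ℝ => 1 / Real.cosh ((v / 2 + ε) * (M₂ μ + ε))) (𝓝[>] 0)
      (𝓝 (1 / Real.cosh (M₂ μ * v / 2))) :=
    (hcont.tendsto' 0 _ (by ring_nf)).mono_left nhdsWithin_le_nhds
  refine le_of_tendsto hlim (eventually_nhdsWithin_of_forall fun ε (hε : 0 < ε) => ?_)
  exact one_div_cosh_le_spectralRadius_of_lt hproper hv hsymm hmom
    (lt_add_of_pos_right _ hε) (lt_add_of_pos_right _ hε)

end TestFunction

end

end RandomWalk

theorem theorem1p1 {Γ : Type*} [Group Γ] [Countable Γ] [MetricSpace Γ]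
    -- left invariance of the distance
    [IsIsometricSMul Γ Γ]
    (hproper : RandomWalk.ProperDist Γ)
    (v : ℝ) (hv : RandomWalk.volumeGrowth Γ = (v : EReal))
    (μ : PMF Γ) (hsymm : RandomWalk.IsSymmetric μ)
    (hmom : RandomWalk.FiniteSecondMoment μ) :
    (∃ ℓ : ℝ, RandomWalk.IsDrift μ ℓ ∧
      ℓ / RandomWalk.M₂ μ ≤ Real.tanh (RandomWalk.M₂ μ * v / 2)) ∧
    (RandomWalk.FiniteEntropy μ ∨ RandomWalk.AtMostExponentialGrowth Γ →
      ∃ h : ℝ, RandomWalk.IsAsymptoticEntropy μ h ∧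
        h ≤ RandomWalk.M₂ μ * v * Real.tanh (RandomWalk.M₂ μ * v / 2)) ∧
    1 / Real.cosh (RandomWalk.M₂ μ * v / 2) ≤ RandomWalk.spectralRadius μ := by
  refine ⟨⟨RandomWalk.drift hmom, RandomWalk.isDrift_drift hmom,
    RandomWalk.drift_div_le_tanh hproper hv hsymm hmom⟩, fun hH => ?_,
    RandomWalk.one_div_cosh_le_spectralRadius hproper hv hsymm hmom⟩
  have hent : RandomWalk.FiniteEntropy μ :=
    hH.elim id fun hg => RandomWalk.finiteEntropy_of_growth hproper hg hmom
  refine ⟨_, RandomWalk.isAsymptoticEntropy_asymptoticEntropy hent, ?_⟩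
  calc RandomWalk.asymptoticEntropy hent ≤ RandomWalk.drift hmom * v :=
        RandomWalk.asymptoticEntropy_le_drift_mul hproper hv hmom hent
    _ ≤ RandomWalk.M₂ μ * Real.tanh (RandomWalk.M₂ μ * v / 2) * v :=
        mul_le_mul_of_nonneg_right (RandomWalk.drift_le_mul_tanh hproper hv hsymm hmom)
          (RandomWalk.nonneg_of_volumeGrowth_eq hproper hv)
    _ = RandomWalk.M₂ μ * v * Real.tanh (RandomWalk.M₂ μ * v / 2) := by ring
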